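/- **Lemma (Wasserstein sewing lemma).** *Setting.* Let $H$ be a separable real Hilbert space and $p\ge 2$. Let $\mathcal P_p(H)$ be the set of Borel probability measures $\mu$ on $H$ with $\|\mu\|_p:=\big(\int_H|x|_H^p\,\mu(dx)\big)^{1/p}<\infty$, and let $W_p(\mu,\nu)=\inf_{\Pi}\big(\int_{H\times H}|x-y|_H^p\,\Pi(dx,dy)\big)^{1/p}$, the infimum being over all couplings $\Pi$ of $\mu$ and $\nu$. Let $(\Omega,\mathcal F,\mathbb P)$ be a probability space with a filtration $(\mathcal F_t)_{t\ge0}$ such that there is an $\mathcal F_0$-measurable random variable uniformly distributed on $[0,1]$. For a random variable $X:\Omega\to H$ put $\|X\|_p=\mathbb E[|X|_H^p]^{1/p}$, and let $L^p_t(H)$ be the set of $\mathcal F_t$-measurable $X:\Omega\to H$ with $\|X\|_p<\infty$. For $X=(X^1,X^2)$ put $\|X\|_p=\|X^1\|_p+\|X^2\|_p$. Let $\Theta_{s,t}:\mathcal P_p(H)\to\mathcal P_p(H)$, $0\le s\le t$, be a family of maps with $\Theta_{t,t}=\mathrm{Id}$. *The $\beta$-sewing property.* Let $\beta>0$. The family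 $\Theta$ satisfies the $\beta$-sewing property with constants $L_{sew},C_{sew}>0$ if there are operators $\mathcal X_{s,r,t}=(\mathcal X^1_{s,r,t},\mathcal X^2_{s,r,t}):L^p_s(H)\times L^p_s(H)\to L^p_t(H)\times L^p_t(H)$, $0\le s\le r\le t$ (acting on random variables), such that, with $\mathcal E^\ell_{s,r,t}(X)=\mathcal X^\ell_{s,r,t}(X)-X^\ell$, $\widehat{\mathcal E}^\ell_{s,r,t}(X)=\mathbb E[\mathcal E^\ell_{s,r,t}(X)\mid\mathcal F_s]$ and $\widetilde{\mathcal E}^\ell_{s,r,t}(X)=\mathcal E^\ell_{s,r,t}(X)-\widehat{\mathcal E}^\ell_{s,r,t}(X)$ for $\ell\in\{1,2\}$, the following hold for all $0\le s\le r\le t$ and all $X=(X^1,X^2)\in L^p_s(H)\times L^p_s(H)$: * (R) if $X^1$ and $X^2$ have laws $\mu^1$ and $\mu^2$, then $\mathcal X^1_{s,r,t}(X)$ has law $\Theta_{s,t}(\mu^1)$ and $\mathcal X^2_{s,r,t}(X)$ has law $\Theta_{r,t}(\Theta_{s,r}(\mu^2))$; * (G) $\|\widehat{\mathcal E}^1_{s,r,t}(X)\|_p\le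 L_{sew}(t-s)(1+\|X^1\|_p)$ and $\|\widetilde{\mathcal E}^1_{s,r,t}(X)\|_p\le L_{sew}(t-s)^{1/2}(1+\|X^1\|_p)$; * (S($\beta$)) $\|\widehat{\mathcal E}^2_{s,r,t}(X)-\widehat{\mathcal E}^1_{s,r,t}(X)\|_p\le C_{sew}(t-s)\big(\|X^1-X^2\|_p+(1+\|X\|_p)(t-s)^\beta\big)$ and $\|\widetilde{\mathcal E}^2_{s,r,t}(X)-\widetilde{\mathcal E}^1_{s,r,t}(X)\|_p\le C_{sew}(t-s)^{1/2}\big(\|X^1-X^2\|_p+(1+\|X\|_p)(t-s)^\beta\big)$. *Partitions.* For a partition $\pi=\{t_0<t_1<\dots<t_N\}$, $N\ge1$, put $|\pi|=\max_{1\le i\le N}(t_i-t_{i-1})$ and $\Theta^\pi=\Theta_{t_{N-1},t_N}\circ\dots\circ\Theta_{t_0,t_1}$. A simple subpartition of $\pi$ is a partition $\pi'\supseteq\pi$ of $[t_0,t_N]$ with at most one additional point in each interval $(t_{k},t_{k+1})$. *Statement.* For all $p\ge2$, $T>0$ and $L_{sew},C_{sew}>0$ there is a constant $C_T\in\mathbb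 R_+$, depending only on $T$, $p$, $L_{sew}$ and $C_{sew}$, such that the following holds for all $H$, $(\Omega,\mathcal F,\mathbb P,(\mathcal F_t)_{t\ge0})$ and $\Theta$ as above and all $\beta>0$ for which $\Theta$ satisfies the $\beta$-sewing property with constants $L_{sew},C_{sew}$. For every partition $\pi=\{t_0<\dots<t_N\}$ with $0\le t_0$ and $t_N\le T$, every simple subpartition $\pi'$ of $\pi$ and all $\mu,\nu\in\mathcal P_p(H)$, $$W_p\big(\Theta^\pi(\mu),\Theta^{\pi'}(\nu)\big)\le C_T\,W_p(\mu,\nu)+C_T\,(1+\|\mu\|_p+\|\nu\|_p)\,(t_N-t_0)^{1/2}\,|\pi|^\beta .$$ In particular, taking $\pi'=\pi$, $$W_p\big(\Theta^\pi(\mu),\Theta^{\pi}(\nu)\big)\le C_T\,W_p(\mu,\nu)+C_T\,(1+\|\mu\|_p+\|\nu\|_p)\,(t_N-t_0)^{1/2}\,|\pi|^\beta .$$ -/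

import Mathlib

open MeasureTheory ProbabilityTheory
open scoped NNReal ENNReal

noncomputable section

namespace WassersteinSewing

/-! ### Measures with finite moment of order `p` and the Wasserstein distance -/

section Measures

variable (H : Type*) [NormedAddCommGroup H] [MeasurableSpace H]

/-- `𝒫_p(H)`: the probability measures `μ` on `H` with `∫ |x|^p μ(dx) < ∞`. -/
def Pp (p : ℝ≥0) : Type _ :=
  {μ : ProbabilityMeasure H // ∫⁻ x, ‖x‖ₑ ^ (p : ℝ) ∂(μ : Measure H) < ∞}

end Measures

section Measures'

variable {H : Type*} [NormedAddCommGroup H] [MeasurableSpace H]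

/-- The underlying measure of an element of `𝒫_p(H)`. -/
def Pp.toMeasure {p : ℝ≥0} (μ : Pp H p) : Measure H := (μ.1 : Measure H)

/-- `‖μ‖_p = (∫ |x|^p μ(dx))^{1/p}`. -/
def Pp.norm {p : ℝ≥0} (μ : Pp H p) : ℝ≥0∞ :=
  (∫⁻ x, ‖x‖ₑ ^ (p : ℝ) ∂μ.toMeasure) ^ (1 / (p : ℝ))

/-- `Γ` is a coupling of `μ` and `ν`: its two marginals are `μ` and `ν`. If `μ` and `ν` are in
`𝒫_p(H)`, then `Γ` is automatically a probability measure with finite moment of order `p`. -/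
def IsCoupling (Γ : Measure (H × H)) (μ ν : Measure H) : Prop :=
  Γ.map Prod.fst = μ ∧ Γ.map Prod.snd = ν

/-- The Wasserstein distance `W_p(μ, ν) = inf_Γ (∫ |x - y|^p Γ(dx, dy))^{1/p}`, the infimum being
over all couplings of `μ` and `ν`. -/
def Wp {p : ℝ≥0} (μ ν : Pp H p) : ℝ≥0∞ :=
  ⨅ (Γ : Measure (H × H)) (_ : IsCoupling Γ μ.toMeasure ν.toMeasure),
    (∫⁻ z, ‖z.1 - z.2‖ₑ ^ (p : ℝ) ∂Γ) ^ (1 / (p : ℝ))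

end Measures'

/-! ### Partitions -/

/-- A partition `t 0 < t 1 < ... < t N` (with `N ≥ 1`) of the interval `[t 0, t N]` of `[0, ∞)`. -/
structure Partition where
  /-- the number of intervals -/
  N : ℕ
  N_pos : 0 < N
  /-- the points of the partition -/
  t : Fin (N + 1) → ℝ≥0
  strictMono : StrictMono t

namespace Partition

/-- The left end point `t_0`. -/
def left (π : Partition) : ℝ≥0 := π.t 0

/-- The right end point `t_N`. -/
def right (π : Partition) : ℝ≥0 := π.t (Fin.last π.N)

/-- The mesh `|π| = max_i (t_{i+1} - t_i)`. -/
def mesh (π : Partition) : ℝ≥0 :=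
  Finset.univ.sup fun i : Fin π.N => π.t i.succ - π.t i.castSucc

/-- `π'` is a simple subpartition of `π`: the points of `π` occur among those of `π'`, at positions
`0 = σ 0 < σ 1 < ... < σ N = N'`, so that both have the same end points, and there is at most one
further point of `π'` strictly between two consecutive points of `π`. -/
def IsSimpleSubpartition (π' π : Partition) : Prop :=
  ∃ σ : Fin (π.N + 1) → Fin (π'.N + 1), StrictMono σ ∧
    σ 0 = 0 ∧ σ (Fin.last π.N) = Fin.last π'.N ∧
    (∀ k, π'.t (σ k) = π.t k) ∧
    ∀ k : Fin π.N, (σ k.succ : ℕ) ≤ (σ k.castSucc : ℕ) + 2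

end Partition

/-- The scheme `Θ^π = Θ_{t_{N-1}, t_N} ∘ ... ∘ Θ_{t_0, t_1}`. -/
def scheme {S : Type*} (Θ : ℝ≥0 → ℝ≥0 → S → S) (π : Partition) (μ : S) : S :=
  Fin.foldl π.N (fun ν i => Θ (π.t i.castSucc) (π.t i.succ) ν) μ

/-! ### Coupling operators on a filtered probability space

Times are in `ℝ≥0`. The differences `t - s` below are only used for `s ≤ t`, and the families `Θ`
and `𝒳` are only constrained at ordered times. -/

section Coupling

variable {Ω : Type*} [mΩ : MeasurableSpace Ω]

/-- There is an `ℱ_0`-measurable real random variable with the uniform law on `[0, 1]`. -/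
def Atomless (P : Measure Ω) (ℱ : Filtration ℝ≥0 mΩ) : Prop :=
  ∃ U : Ω → ℝ, Measurable[ℱ 0] U ∧ P.map U = volume.restrict (Set.Icc (0 : ℝ) 1)

variable {H : Type*} [NormedAddCommGroup H] [MeasurableSpace H]

/-- `‖X‖_p = E[|X|^p]^{1/p}`. -/
def rvNorm (P : Measure Ω) (p : ℝ≥0) (X : Ω → H) : ℝ≥0∞ :=
  (∫⁻ ω, ‖X ω‖ₑ ^ (p : ℝ) ∂P) ^ (1 / (p : ℝ))

variable (H) in
/-- `L^p_t(H)`: the `ℱ_t`-measurable random variables `X : Ω → H` with `‖X‖_p < ∞`. -/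
def Lpt (P : Measure Ω) (ℱ : Filtration ℝ≥0 mΩ) (p : ℝ≥0) (t : ℝ≥0) : Type _ :=
  {X : Ω → H // Measurable[ℱ t] X ∧ rvNorm P p X < ∞}

variable (H) in
/-- Families of operators `𝒳_{s,r,t} : L^p_s(H) × L^p_s(H) → L^p_t(H) × L^p_t(H)`. They act on
random variables, that is, on functions on `Ω`. -/
abbrev CouplingOperator (P : Measure Ω) (ℱ : Filtration ℝ≥0 mΩ) (p : ℝ≥0) : Type _ :=
  ∀ s _r t : ℝ≥0, Lpt H P ℱ p s × Lpt H P ℱ p s → Lpt H P ℱ p t × Lpt H P ℱ p t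

variable {P : Measure Ω} {ℱ : Filtration ℝ≥0 mΩ} {p : ℝ≥0}

/-- The representation property (R):
`Θ_{s,t}(μ¹) = Law(𝒳¹_{s,r,t}(X¹, X²))` and `Θ_{r,t}(Θ_{s,r}(μ²)) = Law(𝒳²_{s,r,t}(X¹, X²))`
whenever `X¹ ∼ μ¹` and `X² ∼ μ²`. -/
def Representation (Θ : ℝ≥0 → ℝ≥0 → Pp H p → Pp H p) (𝒳 : CouplingOperator H P ℱ p) : Prop :=
  ∀ s r t : ℝ≥0, s ≤ r → r ≤ t → ∀ (μ₁ μ₂ : Pp H p) (X : Lpt H P ℱ p s × Lpt H P ℱ p s),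
    P.map X.1.1 = μ₁.toMeasure → P.map X.2.1 = μ₂.toMeasure →
      (Θ s t μ₁).toMeasure = P.map (𝒳 s r t X).1.1 ∧
      (Θ r t (Θ s r μ₂)).toMeasure = P.map (𝒳 s r t X).2.1

/-- The increment `ℰ¹_{s,r,t}(X) = 𝒳¹_{s,r,t}(X) - X¹`. -/
def inc₁ (𝒳 : CouplingOperator H P ℱ p) (s r t : ℝ≥0) (X : Lpt H P ℱ p s × Lpt H P ℱ p s) :
    Ω → H :=
  fun ω => (𝒳 s r t X).1.1 ω - X.1.1 ω

/-- The increment `ℰ²_{s,r,t}(X) = 𝒳²_{s,r,t}(X) - X²`. -/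
def inc₂ (𝒳 : CouplingOperator H P ℱ p) (s r t : ℝ≥0) (X : Lpt H P ℱ p s × Lpt H P ℱ p s) :
    Ω → H :=
  fun ω => (𝒳 s r t X).2.1 ω - X.2.1 ω

variable [NormedSpace ℝ H] [CompleteSpace H]

variable (P ℱ) in
/-- The finite variation part `E[Y | ℱ_s]` of `Y`. -/
def hat (s : ℝ≥0) (Y : Ω → H) : Ω → H := P[Y | ℱ s]

variable (P ℱ) in
/-- The martingale part `Y - E[Y | ℱ_s]` of `Y`. -/
def tilde (s : ℝ≥0) (Y : Ω → H) : Ω → H := fun ω => Y ω - hat P ℱ s Y ω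

/-- The growth assumption (G) with constant `L`. -/
def Growth (𝒳 : CouplingOperator H P ℱ p) (L : ℝ≥0) : Prop :=
  ∀ s r t : ℝ≥0, s ≤ r → r ≤ t → ∀ X : Lpt H P ℱ p s × Lpt H P ℱ p s,
    rvNorm P p (hat P ℱ s (inc₁ 𝒳 s r t X)) ≤
      L * ((t - s : ℝ≥0) : ℝ≥0∞) * (1 + rvNorm P p X.1.1) ∧
    rvNorm P p (tilde P ℱ s (inc₁ 𝒳 s r t X)) ≤
      L * ((t - s : ℝ≥0) : ℝ≥0∞) ^ (1 / 2 : ℝ) * (1 + rvNorm P p X.1.1)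

/-- The stochastic sewing assumption S(β) with constant `C`; the norm of a pair is
`‖X‖_p = ‖X¹‖_p + ‖X²‖_p`. -/
def StochasticSewing (𝒳 : CouplingOperator H P ℱ p) (β : ℝ) (C : ℝ≥0) : Prop :=
  ∀ s r t : ℝ≥0, s ≤ r → r ≤ t → ∀ X : Lpt H P ℱ p s × Lpt H P ℱ p s,
    rvNorm P p (fun ω => hat P ℱ s (inc₂ 𝒳 s r t X) ω - hat P ℱ s (inc₁ 𝒳 s r t X) ω) ≤
      C * ((t - s : ℝ≥0) : ℝ≥0∞) *
        (rvNorm P p (fun ω => X.1.1 ω - X.2.1 ω) +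
          (1 + (rvNorm P p X.1.1 + rvNorm P p X.2.1)) * ((t - s : ℝ≥0) : ℝ≥0∞) ^ β) ∧
    rvNorm P p (fun ω => tilde P ℱ s (inc₂ 𝒳 s r t X) ω - tilde P ℱ s (inc₁ 𝒳 s r t X) ω) ≤
      C * ((t - s : ℝ≥0) : ℝ≥0∞) ^ (1 / 2 : ℝ) *
        (rvNorm P p (fun ω => X.1.1 ω - X.2.1 ω) +
          (1 + (rvNorm P p X.1.1 + rvNorm P p X.2.1)) * ((t - s : ℝ≥0) : ℝ≥0∞) ^ β)

variable (P ℱ) in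
/-- The `β`-sewing property of the family `Θ`, with constants `L_sew = L` and `C_sew = C`: there is
a `β`-coupling family of operators for `Θ` on the filtered probability space `(Ω, ℱ, P)`. -/
def SewingProperty (Θ : ℝ≥0 → ℝ≥0 → Pp H p → Pp H p) (β : ℝ) (L C : ℝ≥0) : Prop :=
  ∃ 𝒳 : CouplingOperator H P ℱ p,
    Representation Θ 𝒳 ∧ Growth 𝒳 L ∧ StochasticSewing 𝒳 β C

end Coupling

end WassersteinSewing

end

open WassersteinSewing

/-! Start from random variables realising any coupling of `μ` and `ν`, and apply the operators `𝒳`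
once per interval of `π`. The middle time is the extra point of `π'` if there is one, and otherwise
the right end point, where `Θ t t` is the identity. By (R) the first component ends with law
`Θ^π(μ)` and the second with law `Θ^{π'}(ν)`, so the `L^p` distance of the two bounds `W_p`.

To control this distance `d k`, split each increment of the difference into its conditional
expectation, of order `h`, and its martingale part, of order `√h`, where `h` is the step length.
Adding up `L^p` norms of order `√h` would diverge as the mesh shrinks. However, `L^p` of a Hilbert
space is 2-smooth for `p ≥ 2`: a conditionally centred `Y` satisfies `‖X + Y‖² ≤ ‖X‖² + K ‖Y‖²`
(`exists_sq_norm_add_le`). The martingale part then contributes only order `h` to `d k ^ 2`, and a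
Gronwall argument (`exists_stochastic_gronwall`) sums the steps. It also yields the factor `√(t_N -
t_0)`.

The error in S(β) involves the norms of both components, while (G) bounds only the first. As norms
depend on laws alone, the second is bounded through a separate chain along `π'`
(`exists_schemeSeq_norm_bound`). Finally the infimum over initial couplings is taken. -/

namespace WassersteinSewing

/-! ### Elementary inequalities for `p`-th powers. -/

lemma pow_one_add_le_one_add_mul {w : ℝ} (hw : 0 ≤ w) (n : ℕ) :
    (1 + w) ^ n ≤ 1 + n * w * (1 + w) ^ n := by
  induction n with
  | zero => simp
  | succ n ih =>
    have h : (1 + w) ^ n ≤ (1 + w) ^ (n + 1) := pow_le_pow_right₀ (by linarith) (by omega)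
    have h2 : 0 ≤ n * w := by positivity
    push_cast
    have e : (1 + w) ^ (n + 1) = (1 + w) ^ n + w * (1 + w) ^ n := by ring
    nlinarith [mul_le_mul_of_nonneg_left h h2, mul_le_mul_of_nonneg_left h hw]

/-- A quantitative Lipschitz bound of `(1 + w) ^ r` at `w = 0`, multiplied by `w`. -/
lemma rpow_one_add_sub_one_mul_le {r w : ℝ} (hr : 0 ≤ r) (hw : -1 ≤ w) (hw' : w ≤ 3) :
    ((1 + w) ^ r - 1) * w ≤ (⌈r⌉₊ * 4 ^ ⌈r⌉₊) * w ^ 2 := by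
  set n := ⌈r⌉₊ with hn
  have hrn : r ≤ n := Nat.le_ceil r
  rcases le_or_gt 0 w with h | h
  · have h1 : (1 + w) ^ r ≤ (1 + w) ^ n := by
      rw [← Real.rpow_natCast]
      exact Real.rpow_le_rpow_of_exponent_le (by linarith) hrn
    have h2 := pow_one_add_le_one_add_mul h n
    have h3 : (1 + w) ^ n ≤ 4 ^ n := pow_le_pow_left₀ (by linarith) (by linarith) n
    have h4 : (1 + w) ^ r - 1 ≤ n * 4 ^ n * w := by
      have : n * w * (1 + w) ^ n ≤ n * w * 4 ^ n := by gcongr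
      linarith
    nlinarith [mul_le_mul_of_nonneg_right h4 h]
  -- A negative factor `w` reverses the inequality, so a lower bound on the power is needed. Since
  -- `1 + w ≤ 1`, raising the exponent to the integer `n` only decreases it, and Bernoulli applies.
  · have h1 : (1 + w) ^ n ≤ (1 + w) ^ r := by
      rw [← Real.rpow_natCast]
      exact Real.rpow_le_rpow_of_exponent_ge' (by linarith) (by linarith) hr hrn
    have h2 := one_add_mul_le_pow (by linarith : -2 ≤ w) n
    have h3 : (n : ℝ) * w ^ 2 ≤ n * 4 ^ n * w ^ 2 := by
      gcongr
      exact le_mul_of_one_le_right (by positivity) (one_le_pow₀ (by norm_num))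
    nlinarith

/-- The graph of `y ^ q` lies above its tangents; here evaluated at `1`. -/
lemma rpow_sub_one_le_tangent {q y : ℝ} (hq : 1 ≤ q) (hy : 0 ≤ y) :
    y ^ q - 1 ≤ q * y ^ (q - 1) * (y - 1) := by
  have hq0 : 0 < q := by linarith
  -- The tangent inequality is weighted AM-GM for `y ^ q` and `1`, after clearing the denominator
  -- `q`.
  have h := Real.geom_mean_le_arith_mean2_weighted (w₁ := (q - 1) / q) (w₂ := 1 / q)
    (p₁ := y ^ q) (p₂ := 1) (div_nonneg (by linarith) hq0.le) (by positivity) (by positivity)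
    zero_le_one (by field_simp; ring)
  rw [← Real.rpow_mul hy, Real.one_rpow, mul_one, mul_div_cancel₀ _ hq0.ne'] at h
  have h2 : q * y ^ (q - 1) ≤ (q - 1) * y ^ q + 1 := by
    calc q * y ^ (q - 1) ≤ q * ((q - 1) / q * y ^ q + 1 / q * 1) := by gcongr
      _ = _ := by field_simp
  have h3 : y ^ q = y ^ (q - 1) * y := by
    conv_lhs => rw [show q = (q - 1) + 1 by ring]
    rw [Real.rpow_add_one' hy (by linarith)]
  rw [h3] at h2 ⊢
  nlinarith

/-- Second order Taylor bound for `w ↦ (1 + w) ^ q`. -/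
lemma rpow_one_add_le_taylor {q w : ℝ} (hq : 1 ≤ q) (hw : -1 ≤ w) (hw' : w ≤ 3) :
    (1 + w) ^ q ≤ 1 + q * w + q * (⌈q - 1⌉₊ * 4 ^ ⌈q - 1⌉₊) * w ^ 2 := by
  -- With `q * (1 + w) ^ (q - 1) * w = q * w + q * ((1 + w) ^ (q - 1) - 1) * w`, the last summand is
  -- of second order in `w`.
  have h1 := rpow_sub_one_le_tangent hq (by linarith : 0 ≤ 1 + w)
  have h2 := rpow_one_add_sub_one_mul_le (by linarith : 0 ≤ q - 1) hw hw'
  have := mul_le_mul_of_nonneg_left h2 (by linarith : 0 ≤ q)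
  nlinarith

/-- Taylor type bound for the `p`-th power of the norm of a sum in a Hilbert space, where `a`, `b`
are the norms of the summands and `i` their inner product. -/
lemma exists_rpow_norm_add_le {p : ℝ} (hp : 2 ≤ p) :
    ∃ c : ℝ, 0 ≤ c ∧ ∀ a b i : ℝ, 0 ≤ a → 0 ≤ b → |i| ≤ a * b →
      (a ^ 2 + 2 * i + b ^ 2) ^ (p / 2) ≤
        a ^ p + p * a ^ (p - 2) * i + c * (a ^ (p - 2) * b ^ 2 + b ^ p) := by
  set C : ℝ := p / 2 * (⌈p / 2 - 1⌉₊ * 4 ^ ⌈p / 2 - 1⌉₊) with hC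
  have hC0 : 0 ≤ C := by positivity
  -- The first two summands serve the case `b ≤ a`, by Taylor expansion around `a ^ 2`. The other
  -- two serve `a < b`, where every term is at most a multiple of `b ^ p`.
  refine ⟨p / 2 + 9 * C + 2 ^ p + p, by positivity, fun a b i ha hb hi => ?_⟩
  have hi1 := (abs_le.1 hi).1
  have hi2 := (abs_le.1 hi).2
  have hbp : 0 ≤ b ^ p := by positivity
  have hap : 0 ≤ a ^ (p - 2) := by positivity
  have h2p : (0 : ℝ) ≤ 2 ^ p := by positivity
  have hsq (x : ℝ) (hx : 0 ≤ x) : (x ^ 2) ^ (p / 2) = x ^ p := by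
    rw [← Real.rpow_natCast, ← Real.rpow_mul hx]; congr 1; push_cast; ring
  have hsplit (x : ℝ) (hx : 0 ≤ x) : x ^ p = x ^ (p - 2) * x ^ 2 := by
    rw [← Real.rpow_natCast x 2, ← Real.rpow_add' hx (by push_cast; linarith)]
    congr 1; push_cast; ring
  have hab : 0 ≤ a ^ (p - 2) * b ^ 2 := by positivity
  rcases le_or_gt b a with h | h
  · rcases ha.eq_or_lt with rfl | ha
    · have : b = 0 := le_antisymm h hb
      subst this
      have : i = 0 := by simpa using hi
      subst this
      simp [Real.zero_rpow (show p ≠ 0 by linarith), Real.zero_rpow (show p / 2 ≠ 0 by linarith)]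
    · set w := (2 * i + b ^ 2) / a ^ 2 with hw
      have ha2 : 0 < a ^ 2 := by positivity
      have hwa : w * a ^ 2 = 2 * i + b ^ 2 := by rw [hw]; field_simp
      have hw1 : -1 ≤ w := by rw [hw, le_div_iff₀ ha2]; nlinarith [sq_nonneg (a - b)]
      have hw3 : w ≤ 3 := by rw [hw, div_le_iff₀ ha2]; nlinarith
      -- Here `b ≤ a` enters; squaring gives the factor 9 in the constant.
      have hz : |2 * i + b ^ 2| ≤ 3 * (a * b) := by rw [abs_le]; constructor <;> nlinarith
      have hw2 : w ^ 2 * a ^ 2 ≤ 9 * b ^ 2 := by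
        have h1 : (w * a ^ 2) ^ 2 ≤ (3 * (a * b)) ^ 2 := by
          rw [hwa]; exact sq_le_sq' (abs_le.1 hz).1 (abs_le.1 hz).2
        have : a ^ 2 * (w ^ 2 * a ^ 2) ≤ a ^ 2 * (9 * b ^ 2) := by nlinarith
        exact le_of_mul_le_mul_left this ha2
      have ht := rpow_one_add_le_taylor (by linarith : 1 ≤ p / 2) hw1 hw3
      rw [← hC] at ht
      have e1 : a ^ 2 + 2 * i + b ^ 2 = a ^ 2 * (1 + w) := by linarith
      rw [e1, Real.mul_rpow ha2.le (by linarith), hsq a ha.le]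
      have hpa : 0 ≤ a ^ p := by positivity
      calc a ^ p * (1 + w) ^ (p / 2) ≤ a ^ p * (1 + p / 2 * w + C * w ^ 2) := by gcongr
        _ = a ^ p + a ^ (p - 2) * (p / 2) * (w * a ^ 2) + a ^ (p - 2) * C * (w ^ 2 * a ^ 2) := by
          rw [hsplit a ha.le]; ring
        _ ≤ a ^ p + a ^ (p - 2) * (p / 2) * (2 * i + b ^ 2) + a ^ (p - 2) * C * (9 * b ^ 2) := by
          rw [hwa]; gcongr
        _ = a ^ p + p * a ^ (p - 2) * i + (p / 2 + 9 * C) * (a ^ (p - 2) * b ^ 2) := by ring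
        _ ≤ _ := by
          have : 0 ≤ (p / 2 + 9 * C) * b ^ p := by positivity
          have : 0 ≤ (2 ^ p + p) * (a ^ (p - 2) * b ^ 2 + b ^ p) := by positivity
          linarith
  · have h1 : (a ^ 2 + 2 * i + b ^ 2) ^ (p / 2) ≤ 2 ^ p * b ^ p := by
      rw [← Real.mul_rpow (by norm_num) hb, ← hsq (2 * b) (by positivity)]
      apply Real.rpow_le_rpow _ _ (by linarith)
      · nlinarith [sq_nonneg (a - b)]
      · nlinarith
    have h2 : -(p * b ^ p) ≤ p * a ^ (p - 2) * i := by
      have : a ^ (p - 2) * -i ≤ b ^ p := by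
        rw [hsplit b hb]
        have : a ^ (p - 2) ≤ b ^ (p - 2) := Real.rpow_le_rpow ha h.le (by linarith)
        have h3 : -i ≤ b ^ 2 := by nlinarith
        exact (mul_le_mul_of_nonneg_left h3 hap).trans
          (mul_le_mul_of_nonneg_right this (by positivity))
      nlinarith
    have : 0 ≤ a ^ p := by positivity
    have : 0 ≤ (p / 2 + 9 * C) * (a ^ (p - 2) * b ^ 2 + b ^ p) := by positivity
    have : 0 ≤ (2 ^ p + p) * (a ^ (p - 2) * b ^ 2) := by positivity
    nlinarith

/-- This turns an error added to a `p`-th power into one added to a square. Bernoulli absorbs `a ^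
(p - 2) * b ^ 2`, superadditivity of `x ↦ x ^ (p / 2)` absorbs `b ^ p`, and the average of the two
bounds handles the sum. -/
lemma exists_add_mul_le_rpow_sq_add {p c : ℝ} (hp : 2 ≤ p) :
    ∃ K : ℝ, 0 ≤ K ∧ ∀ a b : ℝ, 0 ≤ a → 0 ≤ b →
      a ^ p + c * (a ^ (p - 2) * b ^ 2 + b ^ p) ≤ (a ^ 2 + K * b ^ 2) ^ (p / 2) := by
  -- Averaging costs the factor 2, and `1 ≤ K` gives `K ≤ K ^ (p / 2)`.
  refine ⟨max 1 (2 * c), by positivity, fun a b ha hb => ?_⟩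
  set K := max 1 (2 * c)
  have hK1 : 1 ≤ K := le_max_left _ _
  have hKc : 2 * c ≤ K := le_max_right _ _
  have hsq (x : ℝ) (hx : 0 ≤ x) : (x ^ 2) ^ (p / 2) = x ^ p := by
    rw [← Real.rpow_natCast, ← Real.rpow_mul hx]; congr 1; push_cast; ring
  have hsplit (x : ℝ) (hx : 0 ≤ x) : x ^ p = x ^ (p - 2) * x ^ 2 := by
    rw [← Real.rpow_natCast x 2, ← Real.rpow_add' hx (by push_cast; linarith)]
    congr 1; push_cast; ring
  have h1 : a ^ p + p / 2 * K * (a ^ (p - 2) * b ^ 2) ≤ (a ^ 2 + K * b ^ 2) ^ (p / 2) := by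
    rcases ha.eq_or_lt with rfl | ha
    · rcases hp.eq_or_lt with rfl | hp
      · norm_num
      · rw [Real.zero_rpow (by linarith), Real.zero_rpow (by linarith)]
        simp; positivity
    · have := one_add_mul_self_le_rpow_one_add (s := K * b ^ 2 / a ^ 2)
        (by have : 0 ≤ K * b ^ 2 / a ^ 2 := by positivity
            linarith) (by linarith : 1 ≤ p / 2)
      calc a ^ p + p / 2 * K * (a ^ (p - 2) * b ^ 2)
          = a ^ p * (1 + p / 2 * (K * b ^ 2 / a ^ 2)) := by rw [hsplit a ha.le]; field_simp
        _ ≤ a ^ p * (1 + K * b ^ 2 / a ^ 2) ^ (p / 2) := by gcongr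
        _ = _ := by
          rw [← hsq a ha.le, ← Real.mul_rpow (by positivity) (by positivity)]
          congr 1; field_simp
  have h2 : a ^ p + K * b ^ p ≤ (a ^ 2 + K * b ^ 2) ^ (p / 2) := by
    have := NNReal.add_rpow_le_rpow_add (a ^ 2).toNNReal (K * b ^ 2).toNNReal
      (by linarith : 1 ≤ p / 2)
    have := NNReal.coe_le_coe.2 this
    push_cast at this
    rw [Real.coe_toNNReal _ (by positivity), Real.coe_toNNReal _ (by positivity),
      Real.mul_rpow (by positivity) (by positivity), hsq a ha, hsq b hb] at this
    refine le_trans ?_ this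
    gcongr
    exact Real.self_le_rpow_of_one_le hK1 (by linarith)
  have hbp : 0 ≤ b ^ p := by positivity
  have hab : 0 ≤ a ^ (p - 2) * b ^ 2 := by positivity
  have h3 : 2 * c * (a ^ (p - 2) * b ^ 2) ≤ p / 2 * K * (a ^ (p - 2) * b ^ 2) := by
    refine mul_le_mul_of_nonneg_right ?_ hab
    have : 1 * K ≤ p / 2 * K := by gcongr; linarith
    linarith
  have h4 : 2 * c * b ^ p ≤ K * b ^ p := by gcongr
  linarith

/-! ### Two-smoothness of `L^p`. -/

section OneStep

variable {Ω : Type*} {mΩ : MeasurableSpace Ω} {P : Measure Ω}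
  {E : Type*} [NormedAddCommGroup E] {p : ℝ≥0}

lemma integral_norm_rpow_eq {X : Ω → E} (hp : p ≠ 0) (hX : MemLp X p P) :
    ∫ ω, ‖X ω‖ ^ (p : ℝ) ∂P = (eLpNorm X p P).toReal ^ (p : ℝ) := by
  have h0 : 0 ≤ ∫ ω, ‖X ω‖ ^ (p : ℝ) ∂P := integral_nonneg fun _ => by positivity
  rw [hX.eLpNorm_eq_integral_rpow_norm (by simpa using hp) (by simp),
    ENNReal.coe_toReal, ENNReal.toReal_ofReal (by positivity), ← Real.rpow_mul h0,
    inv_mul_cancel₀ (by exact_mod_cast hp), Real.rpow_one]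

lemma integrable_norm_rpow_mul_norm_rpow [IsFiniteMeasure P] {F : Type*} [NormedAddCommGroup F]
    {X : Ω → E} {Y : Ω → F} (hp : p ≠ 0) (hX : MemLp X p P) (hY : MemLp Y p P)
    {u v : ℝ} (hu : 0 ≤ u) (hv : 0 ≤ v) (huv : u + v = p) :
    Integrable (fun ω => ‖X ω‖ ^ u * ‖Y ω‖ ^ v) P := by
  have iX := hX.integrable_norm_rpow (by simpa using hp) (by simp)
  have iY := hY.integrable_norm_rpow (by simpa using hp) (by simp)
  refine (iX.add iY).mono' ?_ (.of_forall fun ω => ?_)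
  · exact ((hX.1.norm.aemeasurable.pow_const _).mul
      (hY.1.norm.aemeasurable.pow_const _)).aestronglyMeasurable
  · simp only [ENNReal.coe_toReal, Pi.add_apply]
    rw [Real.norm_of_nonneg (by positivity), ← huv]
    have hx := norm_nonneg (X ω)
    have hy := norm_nonneg (Y ω)
    rcases le_total ‖X ω‖ ‖Y ω‖ with h | h
    · rw [Real.rpow_add_of_nonneg hy hu hv]
      have := Real.rpow_le_rpow hx h hu
      have : 0 ≤ ‖X ω‖ ^ (u + v) := by positivity
      have : 0 ≤ ‖Y ω‖ ^ v := by positivity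
      nlinarith
    · rw [Real.rpow_add_of_nonneg hx hu hv]
      have := Real.rpow_le_rpow hy h hv
      have : 0 ≤ ‖Y ω‖ ^ (u + v) := by positivity
      have : 0 ≤ ‖X ω‖ ^ u := by positivity
      nlinarith

/-- Hölder's inequality for exponents that add up to `p`. -/
lemma integral_norm_rpow_mul_norm_rpow_le {F : Type*} [NormedAddCommGroup F]
    {X : Ω → E} {Y : Ω → F} (hp : p ≠ 0) (hX : MemLp X p P) (hY : MemLp Y p P)
    {u v : ℝ} (hu : 0 ≤ u) (hv : 0 ≤ v) (huv : u + v = p) :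
    ∫ ω, ‖X ω‖ ^ u * ‖Y ω‖ ^ v ∂P ≤
      (eLpNorm X p P).toReal ^ u * (eLpNorm Y p P).toReal ^ v := by
  have hp0 : (0 : ℝ) < p := by exact_mod_cast pos_iff_ne_zero.2 hp
  have key := ENNReal.lintegral_mul_norm_pow_le (μ := P) (f := fun ω => ‖X ω‖ₑ ^ (p : ℝ))
    (g := fun ω => ‖Y ω‖ₑ ^ (p : ℝ)) (hX.1.enorm.pow_const _) (hY.1.enorm.pow_const _)
    (p := u / p) (q := v / p) (by positivity) (by positivity) (by field_simp; exact huv)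
  have e (Z : ℝ≥0∞) (w : ℝ) : (Z ^ (p : ℝ)) ^ (w / p) = Z ^ w := by
    rw [← ENNReal.rpow_mul]; congr 1; field_simp
  simp only [e] at key
  have hnX : (∫⁻ a, ‖X a‖ₑ ^ (p : ℝ) ∂P) ^ (u / p) = eLpNorm X p P ^ u := by
    rw [eLpNorm_nnreal_eq_lintegral hp, ← ENNReal.rpow_mul]; congr 1; field_simp
  have hnY : (∫⁻ a, ‖Y a‖ₑ ^ (p : ℝ) ∂P) ^ (v / p) = eLpNorm Y p P ^ v := by
    rw [eLpNorm_nnreal_eq_lintegral hp, ← ENNReal.rpow_mul]; congr 1; field_simp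
  rw [hnX, hnY] at key
  have hfin : eLpNorm X p P ^ u * eLpNorm Y p P ^ v ≠ ∞ :=
    ENNReal.mul_ne_top (ENNReal.rpow_ne_top_of_nonneg hu hX.2.ne)
      (ENNReal.rpow_ne_top_of_nonneg hv hY.2.ne)
  have hmeas : AEStronglyMeasurable (fun ω => ‖X ω‖ ^ u * ‖Y ω‖ ^ v) P :=
    ((hX.1.norm.aemeasurable.pow_const _).mul
      (hY.1.norm.aemeasurable.pow_const _)).aestronglyMeasurable
  rw [integral_eq_lintegral_of_nonneg_ae (.of_forall fun ω => by positivity) hmeas,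
    ENNReal.toReal_rpow, ENNReal.toReal_rpow, ← ENNReal.toReal_mul]
  refine ENNReal.toReal_mono hfin (le_of_eq_of_le (lintegral_congr fun ω => ?_) key)
  rw [ENNReal.ofReal_mul (by positivity), ← ENNReal.ofReal_rpow_of_nonneg (norm_nonneg _) hu,
    ← ENNReal.ofReal_rpow_of_nonneg (norm_nonneg _) hv, ofReal_norm, ofReal_norm]

/-- In a Hilbert space, `L^p` is 2-smooth for `p ≥ 2`: adding a conditionally centred increment. -/
lemma exists_sq_norm_add_le (hp : 2 ≤ p) :
    ∃ K : ℝ, 0 ≤ K ∧ ∀ (E : Type*) [NormedAddCommGroup E] [InnerProductSpace ℝ E]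
      [CompleteSpace E] (Ω : Type*) (m mΩ : MeasurableSpace Ω) (P : Measure Ω)
      [IsProbabilityMeasure P] (X Y : Ω → E), m ≤ mΩ →
      AEStronglyMeasurable[m] X P → MemLp X p P → MemLp Y p P → P[Y | m] =ᵐ[P] 0 →
        (eLpNorm (X + Y) p P).toReal ^ 2 ≤
          (eLpNorm X p P).toReal ^ 2 + K * (eLpNorm Y p P).toReal ^ 2 := by
  have hp' : (2 : ℝ) ≤ p := by exact_mod_cast hp
  obtain ⟨c, hc, hpt⟩ := exists_rpow_norm_add_le hp'
  obtain ⟨K, hK, hcK⟩ := exists_add_mul_le_rpow_sq_add (c := c) hp'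
  refine ⟨K, hK, fun E _ _ _ Ω m mΩ P _ X Y hm hXm hX hY hY0 => ?_⟩
  have hp0 : p ≠ 0 := by rintro rfl; norm_num at hp
  have hp1 : (1 : ℝ≥0∞) ≤ p := by exact_mod_cast one_le_two.trans hp
  set a := (eLpNorm X p P).toReal with ha
  set b := (eLpNorm Y p P).toReal with hb
  have ha0 : 0 ≤ a := ENNReal.toReal_nonneg
  have hb0 : 0 ≤ b := ENNReal.toReal_nonneg
  -- the mixed term has mean zero
  let Z : Ω → E := fun ω => ‖X ω‖ ^ ((p : ℝ) - 2) • X ω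
  have hZm : AEStronglyMeasurable[m] Z P := by
    obtain ⟨X', hX', hXX'⟩ := hXm
    refine ⟨fun ω => ‖X' ω‖ ^ ((p : ℝ) - 2) • X' ω, ?_, ?_⟩
    · exact (hX'.norm.measurable.pow_const _).stronglyMeasurable.smul hX'
    · filter_upwards [hXX'] with ω h using by simp [Z, h]
  have hZY : Integrable (fun ω => innerSL ℝ (Z ω) (Y ω)) P := by
    refine (integrable_norm_rpow_mul_norm_rpow hp0 hX hY (u := p - 1) (v := 1) (by linarith)
      zero_le_one (by ring)).mono' ?_ (.of_forall fun ω => ?_)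
    · exact (hZm.mono hm).inner hY.1
    · rw [innerSL_apply_apply]
      refine (norm_inner_le_norm _ _).trans (le_of_eq ?_)
      simp only [Z]
      rw [norm_smul, Real.norm_of_nonneg (by positivity), Real.rpow_one,
        show (p : ℝ) - 1 = (p - 2) + 1 by ring,
        Real.rpow_add_one' (norm_nonneg _) (by linarith)]
  have hmix : ∫ ω, innerSL ℝ (Z ω) (Y ω) ∂P = 0 := by
    rw [← integral_condExp hm]
    have h := condExp_bilin_of_aestronglyMeasurable_left (innerSL ℝ) hZm hZY (hY.integrable hp1)
    refine integral_eq_zero_of_ae ?_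
    filter_upwards [h, hY0] with ω h h0
    rw [h, h0]; simp
  have iX := hX.integrable_norm_rpow (by simpa using hp0) (by simp)
  have iY := hY.integrable_norm_rpow (by simpa using hp0) (by simp)
  have iXY := (hX.add hY).integrable_norm_rpow (by simpa using hp0) (by simp)
  have i2 := integrable_norm_rpow_mul_norm_rpow hp0 hX hY (u := p - 2) (v := 2) (by linarith)
      zero_le_two (by ring)
  simp only [ENNReal.coe_toReal] at iX iY iXY
  have hint : (eLpNorm (X + Y) p P).toReal ^ (p : ℝ) ≤
      a ^ (p : ℝ) + c * (a ^ ((p : ℝ) - 2) * b ^ (2 : ℝ) + b ^ (p : ℝ)) := by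
    rw [← integral_norm_rpow_eq hp0 (hX.add hY), ha, hb, ← integral_norm_rpow_eq hp0 hX,
      ← integral_norm_rpow_eq hp0 hY]
    calc ∫ ω, ‖(X + Y) ω‖ ^ (p : ℝ) ∂P
        ≤ ∫ ω, (‖X ω‖ ^ (p : ℝ) + p * innerSL ℝ (Z ω) (Y ω) +
            c * (‖X ω‖ ^ ((p : ℝ) - 2) * ‖Y ω‖ ^ (2 : ℝ) + ‖Y ω‖ ^ (p : ℝ))) ∂P := by
          refine integral_mono iXY ((iX.add (hZY.const_mul _)).add ((i2.add iY).const_mul c))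
            fun ω => ?_
          have := hpt ‖X ω‖ ‖Y ω‖ (inner ℝ (X ω) (Y ω)) (norm_nonneg _) (norm_nonneg _)
            (abs_real_inner_le_norm _ _)
          rw [← norm_add_sq_real, ← Real.rpow_natCast, ← Real.rpow_mul (norm_nonneg _),
            show ((2 : ℕ) : ℝ) * ((p : ℝ) / 2) = p by push_cast; ring] at this
          simp only [Pi.add_apply, innerSL_apply_apply, Z, real_inner_smul_left, Real.rpow_two]
          linarith
      _ = ∫ ω, ‖X ω‖ ^ (p : ℝ) ∂P + c * (∫ ω, ‖X ω‖ ^ ((p : ℝ) - 2) * ‖Y ω‖ ^ (2 : ℝ) ∂P +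
            ∫ ω, ‖Y ω‖ ^ (p : ℝ) ∂P) := by
          rw [integral_add (f := fun ω => ‖X ω‖ ^ (p : ℝ) + p * innerSL ℝ (Z ω) (Y ω))
              (g := fun ω => c * (‖X ω‖ ^ ((p : ℝ) - 2) * ‖Y ω‖ ^ (2 : ℝ) + ‖Y ω‖ ^ (p : ℝ)))
              (iX.add (hZY.const_mul _)) ((i2.add iY).const_mul c),
            integral_add iX (hZY.const_mul _), integral_const_mul, integral_const_mul, hmix,
            integral_add i2 iY, mul_zero, add_zero]
      _ ≤ _ := by
          gcongr
          exact integral_norm_rpow_mul_norm_rpow_le hp0 hX hY (by linarith) zero_le_two (by ring)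
  -- Hölder has left the same expression in the norms `a`, `b` as in the pointwise bound, so it is a
  -- `p / 2`-th power of the desired right-hand side.
  have h := hint.trans (by simpa using hcK a b ha0 hb0)
  have h0 : 0 ≤ (eLpNorm (X + Y) p P).toReal := ENNReal.toReal_nonneg
  have e : (eLpNorm (X + Y) p P).toReal ^ (p : ℝ) =
      ((eLpNorm (X + Y) p P).toReal ^ 2) ^ ((p : ℝ) / 2) := by
    rw [← Real.rpow_natCast, ← Real.rpow_mul h0]; congr 1; push_cast; ring
  rw [e] at h
  exact (Real.rpow_le_rpow_iff (by positivity) (by positivity) (by positivity)).1 h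

end OneStep

/-! ### Discrete Gronwall inequalities. -/

section Gronwall

/-- Discrete Gronwall inequality. -/
lemma discrete_gronwall {x t : ℕ → ℝ} {A e : ℝ} (he : 0 ≤ e) (hx : ∀ k, 0 ≤ x k)
    {n : ℕ} (ht : ∀ k < n, t k ≤ t (k + 1))
    (hstep : ∀ k < n, x (k + 1) ≤ x k + A * (t (k + 1) - t k) * (x k + e)) :
    x n + e ≤ Real.exp (A * (t n - t 0)) * (x 0 + e) := by
  induction n with
  | zero => simp
  | succ n ih =>
    have ih := ih (fun k hk => ht k (hk.trans n.lt_succ_self))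
      fun k hk => hstep k (hk.trans n.lt_succ_self)
    have h1 := hstep n n.lt_succ_self
    have h2 := Real.add_one_le_exp (A * (t (n + 1) - t n))
    have h3 : 0 ≤ x n + e := add_nonneg (hx n) he
    calc x (n + 1) + e ≤ (A * (t (n + 1) - t n) + 1) * (x n + e) := by linarith
      _ ≤ Real.exp (A * (t (n + 1) - t n)) * (x n + e) := by gcongr
      _ ≤ Real.exp (A * (t (n + 1) - t n)) * (Real.exp (A * (t n - t 0)) * (x 0 + e)) := by gcongr
      _ = _ := by rw [← mul_assoc, ← Real.exp_add]; ring_nf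

/-- Discrete Gronwall inequality for a quantity with a drift of order `h` and a martingale part of
order `h ^ (1 / 2)`, the latter entering quadratically. -/
lemma exists_stochastic_gronwall {K C T : ℝ} (hK : 0 ≤ K) (hC : 0 ≤ C) (hT : 0 ≤ T) :
    ∃ G : ℝ, 0 ≤ G ∧ ∀ (d u v t : ℕ → ℝ) (e : ℝ) (n : ℕ), 0 ≤ e → (∀ k, 0 ≤ d k) →
      (∀ k, 0 ≤ u k) → (∀ k, 0 ≤ v k) →
      (∀ k < n, t k ≤ t (k + 1)) → (∀ k < n, t (k + 1) - t k ≤ T) → t n - t 0 ≤ T →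
      (∀ k < n, d (k + 1) ^ 2 ≤ (d k + u k) ^ 2 + K * v k ^ 2) →
      (∀ k < n, u k ≤ C * (t (k + 1) - t k) * (d k + e)) →
      (∀ k < n, v k ≤ C * √(t (k + 1) - t k) * (d k + e)) →
      d n ≤ G * (d 0 + √(t n - t 0) * e) := by
  -- The summands come from the cross term, the squared drift (with `h ^ 2 ≤ T * h`) and the
  -- martingale part. The factor 2 comes from `(d + e) ^ 2 ≤ 2 * (d ^ 2 + e ^ 2)`.
  set A : ℝ := 2 * (2 * C + C ^ 2 * T + K * C ^ 2) with hA
  have hA0 : 0 ≤ A := by positivity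
  refine ⟨√(Real.exp (A * T) * (1 + A)), by positivity, ?_⟩
  intro d u v t e n he hd hu hv ht htT htn hduv hu' hv'
  have hmono : t 0 ≤ t n := by
    clear htn hduv hu' hv' htT
    induction n with
    | zero => rfl
    | succ n ih => exact (ih fun k hk => ht k (by omega)).trans (ht n (by omega))
  have hτ : 0 ≤ t n - t 0 := by linarith
  have hg := discrete_gronwall (x := fun k => d k ^ 2) (t := t) (A := A) (e := e ^ 2)
    (by positivity) (fun k => by positivity) ht (fun k hk => ?_)
  · set τ := t n - t 0
    have h1 : Real.exp (A * τ) ≤ Real.exp (A * T) := by gcongr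
    -- Keeping a factor `τ` in front of `e ^ 2` is what produces `√τ * e` after taking roots.
    have h2 : Real.exp (A * τ) - 1 ≤ A * τ * Real.exp (A * τ) := by
      have := Real.add_one_le_exp (-(A * τ))
      have h3 : Real.exp (-(A * τ)) * Real.exp (A * τ) = 1 := by rw [← Real.exp_add]; simp
      nlinarith [Real.exp_pos (A * τ)]
    have h4 : d n ^ 2 ≤ (√(Real.exp (A * T) * (1 + A)) * (d 0 + √τ * e)) ^ 2 := by
      rw [mul_pow, Real.sq_sqrt (by positivity)]
      have h5 : d 0 ^ 2 + τ * e ^ 2 ≤ (d 0 + √τ * e) ^ 2 := by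
        have : 0 ≤ d 0 * (√τ * e) := mul_nonneg (hd 0) (by positivity)
        nlinarith [Real.sq_sqrt hτ]
      calc d n ^ 2 ≤ Real.exp (A * τ) * d 0 ^ 2 + (Real.exp (A * τ) - 1) * e ^ 2 := by
            linarith
        _ ≤ Real.exp (A * τ) * d 0 ^ 2 + (A * τ * Real.exp (A * τ)) * e ^ 2 := by gcongr
        _ = Real.exp (A * τ) * (d 0 ^ 2 + A * (τ * e ^ 2)) := by ring
        _ ≤ Real.exp (A * T) * ((1 + A) * (d 0 ^ 2 + τ * e ^ 2)) := by
            gcongr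
            have : 0 ≤ A * d 0 ^ 2 := by positivity
            have : 0 ≤ τ * e ^ 2 := by positivity
            linarith
        _ ≤ Real.exp (A * T) * ((1 + A) * (d 0 + √τ * e) ^ 2) := by gcongr
        _ = _ := by ring
    exact (pow_le_pow_iff_left₀ (hd n)
      (mul_nonneg (Real.sqrt_nonneg _) (add_nonneg (hd 0) (by positivity))) two_ne_zero).1 h4
  · set h := t (k + 1) - t k with hh
    have hh0 : 0 ≤ h := by linarith [ht k hk]
    have hhT : h ≤ T := htT k hk
    set z := d k + e with hz
    have hz0 : 0 ≤ z := add_nonneg (hd k) he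
    have hdz : d k ≤ z := by linarith
    have hd0 := hd k
    have h1 : (d k + u k) ^ 2 ≤ (d k + C * h * z) ^ 2 := by
      have := hu k
      gcongr
      exact hu' k hk
    have h2 : v k ^ 2 ≤ C ^ 2 * h * z ^ 2 := by
      have : v k ^ 2 ≤ (C * √h * z) ^ 2 := by
        have := hv k
        gcongr
        exact hv' k hk
      rwa [mul_pow, mul_pow, Real.sq_sqrt hh0] at this
    have h3 : z ^ 2 ≤ 2 * (d k ^ 2 + e ^ 2) := by nlinarith [sq_nonneg (d k - e)]
    have h4 : d k * (C * h * z) ≤ C * h * z ^ 2 := by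
      have : d k * (C * h * z) ≤ z * (C * h * z) := by gcongr
      linarith
    have h5 : C ^ 2 * h ^ 2 * z ^ 2 ≤ C ^ 2 * T * h * z ^ 2 := by
      have : C ^ 2 * h * z ^ 2 * h ≤ C ^ 2 * h * z ^ 2 * T := by gcongr
      linarith
    calc d (k + 1) ^ 2 ≤ (d k + u k) ^ 2 + K * v k ^ 2 := hduv k hk
      _ ≤ (d k + C * h * z) ^ 2 + K * (C ^ 2 * h * z ^ 2) := by gcongr
      _ ≤ d k ^ 2 + (2 * C + C ^ 2 * T + K * C ^ 2) * h * z ^ 2 := by nlinarith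
      _ ≤ d k ^ 2 + (2 * C + C ^ 2 * T + K * C ^ 2) * h * (2 * (d k ^ 2 + e ^ 2)) := by gcongr
      _ = _ := by rw [hA]; ring

end Gronwall

/-! ### Chains of coupled random variables and their laws. -/

section RandomVariables

variable {Ω : Type*} [mΩ : MeasurableSpace Ω] {P : Measure Ω} {ℱ : Filtration ℝ≥0 mΩ} {p : ℝ≥0}
  {H : Type*} [NormedAddCommGroup H]

lemma rvNorm_eq_eLpNorm (hp : p ≠ 0) (X : Ω → H) : rvNorm P p X = eLpNorm X p P :=
  (eLpNorm_nnreal_eq_lintegral hp).symm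

variable [MeasurableSpace H]

lemma Lpt.measurable {t : ℝ≥0} (X : Lpt H P ℱ p t) : Measurable X.1 :=
  X.2.1.mono (ℱ.le t) le_rfl

lemma Lpt.rvNorm_ne_top {t : ℝ≥0} (X : Lpt H P ℱ p t) : rvNorm P p X.1 ≠ ∞ := X.2.2.ne

/-- Iterating a coupling operator along the times `t 0 ≤ r 0 ≤ t 1 ≤ r 1 ≤ ...`. -/
def chain (𝒳 : CouplingOperator H P ℱ p) (t r : ℕ → ℝ≥0)
    (X : Lpt H P ℱ p (t 0) × Lpt H P ℱ p (t 0)) :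
    ∀ k, Lpt H P ℱ p (t k) × Lpt H P ℱ p (t k)
  | 0 => X
  | k + 1 => 𝒳 (t k) (r k) (t (k + 1)) (chain 𝒳 t r X k)

/-- Property (R) sees its arguments only through their laws, so it can be iterated although the
components become dependent on the whole past. -/
lemma map_chain_eq {Θ : ℝ≥0 → ℝ≥0 → Pp H p → Pp H p} {𝒳 : CouplingOperator H P ℱ p}
    (h𝒳 : Representation Θ 𝒳) {t r : ℕ → ℝ≥0} {X : Lpt H P ℱ p (t 0) × Lpt H P ℱ p (t 0)}
    {μ ν : ℕ → Pp H p} {n : ℕ} (htr : ∀ k < n, t k ≤ r k ∧ r k ≤ t (k + 1))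
    (hμ : ∀ k < n, μ (k + 1) = Θ (t k) (t (k + 1)) (μ k))
    (hν : ∀ k < n, ν (k + 1) = Θ (r k) (t (k + 1)) (Θ (t k) (r k) (ν k)))
    (hX : P.map X.1.1 = (μ 0).toMeasure ∧ P.map X.2.1 = (ν 0).toMeasure) :
    P.map (chain 𝒳 t r X n).1.1 = (μ n).toMeasure ∧
      P.map (chain 𝒳 t r X n).2.1 = (ν n).toMeasure := by
  induction n with
  | zero => exact hX
  | succ n ih =>
    obtain ⟨h1, h2⟩ := ih (fun k hk => htr k (by omega)) (fun k hk => hμ k (by omega))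
      (fun k hk => hν k (by omega))
    have h := h𝒳 (t n) (r n) (t (n + 1)) (htr n (by omega)).1 (htr n (by omega)).2 _ _ _ h1 h2
    rw [hμ n (by omega), hν n (by omega)]
    exact ⟨h.1.symm, h.2.symm⟩

variable [BorelSpace H]

lemma rvNorm_eq_norm_of_map_eq {X : Ω → H} (hX : Measurable X) {μ : Pp H p}
    (h : P.map X = μ.toMeasure) : rvNorm P p X = μ.norm := by
  rw [rvNorm, Pp.norm, ← h, lintegral_map (by fun_prop) hX]

variable [SecondCountableTopology H]

lemma Lpt.stronglyMeasurable {t : ℝ≥0} (X : Lpt H P ℱ p t) : StronglyMeasurable[ℱ t] X.1 :=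
  X.2.1.stronglyMeasurable

lemma Lpt.memLp {t : ℝ≥0} (hp : p ≠ 0) (X : Lpt H P ℱ p t) : MemLp X.1 p P :=
  ⟨X.measurable.aestronglyMeasurable, by rw [← rvNorm_eq_eLpNorm hp]; exact X.2.2⟩

end RandomVariables

/-! ### Moment and stability estimates along a chain. -/

section Increments

variable {p : ℝ≥0}

/-- Adding an increment, split into its conditional expectation and its martingale part. -/
lemma exists_sq_norm_add_increment_le (hp : 2 ≤ p) :
    ∃ K : ℝ, 0 ≤ K ∧ ∀ (H : Type*) [NormedAddCommGroup H] [InnerProductSpace ℝ H]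
      [CompleteSpace H] (Ω : Type*) [mΩ : MeasurableSpace Ω] (P : Measure Ω)
      [IsProbabilityMeasure P] (ℱ : Filtration ℝ≥0 mΩ) (s : ℝ≥0) (D Y : Ω → H),
      StronglyMeasurable[ℱ s] D → MemLp D p P → MemLp Y p P →
        (rvNorm P p (fun ω => D ω + Y ω)).toReal ^ 2 ≤
          ((rvNorm P p D).toReal + (rvNorm P p (hat P ℱ s Y)).toReal) ^ 2 +
            K * (rvNorm P p (tilde P ℱ s Y)).toReal ^ 2 := by
  obtain ⟨K, hK, h⟩ := exists_sq_norm_add_le hp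
  refine ⟨K, hK, fun H _ _ _ Ω mΩ P _ ℱ s D Y hDm hD hY => ?_⟩
  have hp0 : p ≠ 0 := by rintro rfl; norm_num at hp
  have hp1 : (1 : ℝ≥0∞) ≤ p := by exact_mod_cast one_le_two.trans hp
  simp only [rvNorm_eq_eLpNorm hp0]
  have hA : MemLp (hat P ℱ s Y) p P := hY.condExp hp1
  have hAm : StronglyMeasurable[ℱ s] (hat P ℱ s Y) := stronglyMeasurable_condExp
  have hM : MemLp (tilde P ℱ s Y) p P := hY.sub hA
  have hM0 : P[tilde P ℱ s Y | ℱ s] =ᵐ[P] 0 := by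
    have h1 := condExp_sub (hY.integrable hp1) (hA.integrable hp1) (ℱ s)
    rw [condExp_of_stronglyMeasurable (ℱ.le s) hAm (hA.integrable hp1)] at h1
    filter_upwards [h1] with ω h1
    rw [show tilde P ℱ s Y = Y - hat P ℱ s Y from rfl, h1]
    simp [hat]
  have key := h H Ω (ℱ s) mΩ P (D + hat P ℱ s Y) (tilde P ℱ s Y) (ℱ.le s)
    (hDm.add hAm).aestronglyMeasurable (hD.add hA) hM hM0
  have e : (D + hat P ℱ s Y) + tilde P ℱ s Y = fun ω => D ω + Y ω := by
    ext ω; simp [tilde]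
  rw [e] at key
  refine key.trans ?_
  gcongr
  rw [← ENNReal.toReal_add hD.2.ne hA.2.ne]
  exact ENNReal.toReal_mono (ENNReal.add_ne_top.2 ⟨hD.2.ne, hA.2.ne⟩)
    (eLpNorm_add_le hD.1 hA.1 hp1)

/-- A priori bound on the first component of a chain. -/
lemma exists_chain_growth_bound (hp : 2 ≤ p) (T L : ℝ≥0) :
    ∃ B : ℝ, 0 ≤ B ∧ ∀ (H : Type*) [NormedAddCommGroup H] [InnerProductSpace ℝ H]
      [CompleteSpace H] [SecondCountableTopology H] [MeasurableSpace H] [BorelSpace H]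
      (Ω : Type*) [mΩ : MeasurableSpace Ω] (P : Measure Ω)
      [IsProbabilityMeasure P] (ℱ : Filtration ℝ≥0 mΩ) (𝒳 : CouplingOperator H P ℱ p),
      Growth 𝒳 L → ∀ (t r : ℕ → ℝ≥0) (X : Lpt H P ℱ p (t 0) × Lpt H P ℱ p (t 0)) (n : ℕ),
      (∀ k, t k ≤ T) → (∀ k < n, t k ≤ r k ∧ r k ≤ t (k + 1)) →
        (rvNorm P p (chain 𝒳 t r X n).1.1).toReal ≤ B * (1 + (rvNorm P p X.1.1).toReal) := by
  obtain ⟨K, hK, hstep⟩ := exists_sq_norm_add_increment_le hp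
  obtain ⟨G, hG, hgron⟩ := exists_stochastic_gronwall hK L.coe_nonneg T.coe_nonneg
  have hp0 : p ≠ 0 := by rintro rfl; norm_num at hp
  refine ⟨G * (1 + √T), by positivity, ?_⟩
  intro H _ _ _ _ _ _ Ω mΩ P _ ℱ 𝒳 hgrowth t r X n htT htr
  set Z := chain 𝒳 t r X with hZ
  have hts (k) (hk : k < n) : ((t (k + 1) - t k : ℝ≥0) : ℝ) = t (k + 1) - t k :=
    NNReal.coe_sub ((htr k hk).1.trans (htr k hk).2)
  -- The error level is `e = 1`, matching the factor `1 + ‖X¹‖_p` in (G).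
  have key := hgron (fun k => (rvNorm P p (Z k).1.1).toReal)
    (fun k => (rvNorm P p (hat P ℱ (t k) (inc₁ 𝒳 (t k) (r k) (t (k + 1)) (Z k)))).toReal)
    (fun k => (rvNorm P p (tilde P ℱ (t k) (inc₁ 𝒳 (t k) (r k) (t (k + 1)) (Z k)))).toReal)
    (fun k => t k) 1 n zero_le_one (fun _ => ENNReal.toReal_nonneg)
    (fun _ => ENNReal.toReal_nonneg) (fun _ => ENNReal.toReal_nonneg)
    (fun k hk => NNReal.coe_le_coe.2 ((htr k hk).1.trans (htr k hk).2))
    (fun k hk => ?_) ?_ (fun k hk => ?_) (fun k hk => ?_) (fun k hk => ?_)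
  · refine key.trans ?_
    have h1 : √((t n : ℝ) - t 0) ≤ √T := by
      gcongr
      have : (t n : ℝ) ≤ T := htT n
      have : (0 : ℝ) ≤ t 0 := (t 0).coe_nonneg
      linarith
    have h2 : 0 ≤ (rvNorm P p X.1.1).toReal := ENNReal.toReal_nonneg
    rw [mul_assoc]
    change G * ((rvNorm P p X.1.1).toReal + _) ≤ _
    gcongr
    nlinarith [Real.sqrt_nonneg (T : ℝ)]
  · have : (t (k + 1) : ℝ) ≤ T := htT _
    have : (0 : ℝ) ≤ t k := (t k).coe_nonneg
    linarith
  · have : (t n : ℝ) ≤ T := htT _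
    have : (0 : ℝ) ≤ t 0 := (t 0).coe_nonneg
    linarith
  · have h := hstep H Ω P ℱ (t k) (Z k).1.1 (inc₁ 𝒳 (t k) (r k) (t (k + 1)) (Z k))
      (Z k).1.stronglyMeasurable ((Z k).1.memLp hp0)
      (((Z (k + 1)).1.memLp hp0).sub ((Z k).1.memLp hp0))
    have e : (fun ω => (Z k).1.1 ω + inc₁ 𝒳 (t k) (r k) (t (k + 1)) (Z k) ω) =
        (Z (k + 1)).1.1 := by
      ext ω; simp [inc₁, hZ, chain]
    rwa [e] at h
  · have h := (hgrowth (t k) (r k) (t (k + 1)) (htr k hk).1 (htr k hk).2 (Z k)).1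
    have h := ENNReal.toReal_mono (by finiteness [(Z k).1.rvNorm_ne_top]) h
    rw [ENNReal.toReal_mul, ENNReal.toReal_mul, ENNReal.toReal_add (by simp)
      (Z k).1.rvNorm_ne_top] at h
    rwa [ENNReal.coe_toReal, ENNReal.coe_toReal, hts k hk, ENNReal.toReal_one, add_comm 1] at h
  · have h := (hgrowth (t k) (r k) (t (k + 1)) (htr k hk).1 (htr k hk).2 (Z k)).2
    have h := ENNReal.toReal_mono (by finiteness [(Z k).1.rvNorm_ne_top]) h
    rw [ENNReal.toReal_mul, ENNReal.toReal_mul, ENNReal.toReal_add (by simp)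
      (Z k).1.rvNorm_ne_top, ← ENNReal.toReal_rpow, ← Real.sqrt_eq_rpow] at h
    rwa [ENNReal.coe_toReal, ENNReal.coe_toReal, hts k hk, ENNReal.toReal_one, add_comm 1] at h

/-- Stability of the two components of a chain with respect to each other, given an a priori
bound `R` on them. -/
lemma exists_chain_difference_bound (hp : 2 ≤ p) (T C : ℝ≥0) :
    ∃ G : ℝ, 0 ≤ G ∧ ∀ (H : Type*) [NormedAddCommGroup H] [InnerProductSpace ℝ H]
      [CompleteSpace H] [SecondCountableTopology H] [MeasurableSpace H] [BorelSpace H]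
      (Ω : Type*) [mΩ : MeasurableSpace Ω] (P : Measure Ω)
      [IsProbabilityMeasure P] (ℱ : Filtration ℝ≥0 mΩ) (𝒳 : CouplingOperator H P ℱ p)
      (β : ℝ), 0 < β → StochasticSewing 𝒳 β C →
      ∀ (t r : ℕ → ℝ≥0) (X : Lpt H P ℱ p (t 0) × Lpt H P ℱ p (t 0)) (n : ℕ) (R : ℝ) (h : ℝ≥0),
      (∀ k, t k ≤ T) → (∀ k < n, t k ≤ r k ∧ r k ≤ t (k + 1)) → 0 ≤ R →
      (∀ k < n, (rvNorm P p (chain 𝒳 t r X k).1.1).toReal +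
        (rvNorm P p (chain 𝒳 t r X k).2.1).toReal ≤ R) → (∀ k < n, t (k + 1) - t k ≤ h) →
        (rvNorm P p (fun ω => (chain 𝒳 t r X n).1.1 ω - (chain 𝒳 t r X n).2.1 ω)).toReal ≤
          G * ((rvNorm P p (fun ω => X.1.1 ω - X.2.1 ω)).toReal +
            √(t n - t 0) * ((1 + R) * (h : ℝ) ^ β)) := by
  obtain ⟨K, hK, hstep⟩ := exists_sq_norm_add_increment_le hp
  obtain ⟨G, hG, hgron⟩ := exists_stochastic_gronwall hK C.coe_nonneg T.coe_nonneg
  have hp0 : p ≠ 0 := by rintro rfl; norm_num at hp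
  have hp1 : (1 : ℝ≥0∞) ≤ p := by exact_mod_cast one_le_two.trans hp
  refine ⟨G, hG, ?_⟩
  intro H _ _ _ _ _ _ Ω mΩ P _ ℱ 𝒳 β hβ hsew t r X n R h htT htr hR0 hR hh
  set Z := chain 𝒳 t r X with hZ
  set D : ℕ → Ω → H := fun k ω => (Z k).1.1 ω - (Z k).2.1 ω with hD
  have hDL (k) : MemLp (D k) p P := ((Z k).1.memLp hp0).sub ((Z k).2.memLp hp0)
  have hDn (k) : rvNorm P p (D k) ≠ ∞ := by rw [rvNorm_eq_eLpNorm hp0]; exact (hDL k).2.ne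
  set Y₁ : ℕ → Ω → H := fun k => inc₁ 𝒳 (t k) (r k) (t (k + 1)) (Z k)
  set Y₂ : ℕ → Ω → H := fun k => inc₂ 𝒳 (t k) (r k) (t (k + 1)) (Z k)
  have hY₁ (k) : MemLp (Y₁ k) p P := ((Z (k + 1)).1.memLp hp0).sub ((Z k).1.memLp hp0)
  have hY₂ (k) : MemLp (Y₂ k) p P := ((Z (k + 1)).2.memLp hp0).sub ((Z k).2.memLp hp0)
  -- S(β) bounds differences of the separate parts, in the opposite order. Linearity of the
  -- conditional expectation, valid almost surely, and symmetry of the norm transfer it to the parts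
  -- of `Y₁ k - Y₂ k`.
  have hats (k) : hat P ℱ (t k) (Y₁ k - Y₂ k) =ᵐ[P]
      hat P ℱ (t k) (Y₁ k) - hat P ℱ (t k) (Y₂ k) :=
    condExp_sub ((hY₁ k).integrable hp1) ((hY₂ k).integrable hp1) _
  have hhat (k) : rvNorm P p (hat P ℱ (t k) (Y₁ k - Y₂ k)) =
      rvNorm P p (fun ω => hat P ℱ (t k) (Y₂ k) ω - hat P ℱ (t k) (Y₁ k) ω) := by
    rw [rvNorm_eq_eLpNorm hp0, rvNorm_eq_eLpNorm hp0]
    refine eLpNorm_congr_norm_ae ?_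
    filter_upwards [hats k] with ω hω
    rw [hω, Pi.sub_apply, norm_sub_rev]
  have htilde (k) : rvNorm P p (tilde P ℱ (t k) (Y₁ k - Y₂ k)) =
      rvNorm P p (fun ω => tilde P ℱ (t k) (Y₂ k) ω - tilde P ℱ (t k) (Y₁ k) ω) := by
    rw [rvNorm_eq_eLpNorm hp0, rvNorm_eq_eLpNorm hp0]
    refine eLpNorm_congr_norm_ae ?_
    filter_upwards [hats k] with ω hω
    rw [← norm_neg]
    congr 1
    simp only [tilde, hω, Pi.sub_apply]
    abel
  have hts (k) (hk : k < n) : ((t (k + 1) - t k : ℝ≥0) : ℝ) = t (k + 1) - t k :=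
    NNReal.coe_sub ((htr k hk).1.trans (htr k hk).2)
  -- The bounds `R` and `h` replace the error of S(β) by one independent of `k`, as the Gronwall
  -- inequality requires.
  have herr (k) (hk : k < n) :
      (rvNorm P p (D k) + (1 + (rvNorm P p (Z k).1.1 + rvNorm P p (Z k).2.1)) *
        ((t (k + 1) - t k : ℝ≥0) : ℝ≥0∞) ^ β) ≠ ∞ ∧
      (rvNorm P p (D k) + (1 + (rvNorm P p (Z k).1.1 + rvNorm P p (Z k).2.1)) *
        ((t (k + 1) - t k : ℝ≥0) : ℝ≥0∞) ^ β).toReal ≤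
        (rvNorm P p (D k)).toReal + (1 + R) * (h : ℝ) ^ β := by
    have f1 := (Z k).1.rvNorm_ne_top
    have f2 := (Z k).2.rvNorm_ne_top
    have f3 : ((t (k + 1) - t k : ℝ≥0) : ℝ≥0∞) ^ β ≠ ∞ :=
      ENNReal.rpow_ne_top_of_nonneg hβ.le ENNReal.coe_ne_top
    have f4 := hDn k
    refine ⟨by finiteness, ?_⟩
    rw [ENNReal.toReal_add f4 (by finiteness), ENNReal.toReal_mul,
      ENNReal.toReal_add (by simp) (by finiteness), ENNReal.toReal_add f1 f2,
      ← ENNReal.toReal_rpow]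
    have h1 := hR k hk
    have h2 : ((t (k + 1) - t k : ℝ≥0) : ℝ) ≤ h := hh k hk
    rw [ENNReal.toReal_one, ENNReal.coe_toReal]
    gcongr
  have key := hgron (fun k => (rvNorm P p (D k)).toReal)
    (fun k => (rvNorm P p (hat P ℱ (t k) (Y₁ k - Y₂ k))).toReal)
    (fun k => (rvNorm P p (tilde P ℱ (t k) (Y₁ k - Y₂ k))).toReal)
    (fun k => t k) ((1 + R) * (h : ℝ) ^ β) n (by positivity) (fun _ => ENNReal.toReal_nonneg)
    (fun _ => ENNReal.toReal_nonneg) (fun _ => ENNReal.toReal_nonneg)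
    (fun k hk => NNReal.coe_le_coe.2 ((htr k hk).1.trans (htr k hk).2))
    (fun k hk => ?_) ?_ (fun k hk => ?_) (fun k hk => ?_) (fun k hk => ?_)
  · exact key
  · have : (t (k + 1) : ℝ) ≤ T := htT _
    have : (0 : ℝ) ≤ t k := (t k).coe_nonneg
    linarith
  · have : (t n : ℝ) ≤ T := htT _
    have : (0 : ℝ) ≤ t 0 := (t 0).coe_nonneg
    linarith
  · have h := hstep H Ω P ℱ (t k) (D k) (Y₁ k - Y₂ k)
      ((Z k).1.stronglyMeasurable.sub (Z k).2.stronglyMeasurable) (hDL k) ((hY₁ k).sub (hY₂ k))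
    have e : (fun ω => D k ω + (Y₁ k - Y₂ k) ω) = D (k + 1) := by
      ext ω
      simp only [hD, Pi.sub_apply, Y₁, Y₂, inc₁, inc₂, hZ, chain]
      abel
    rwa [e] at h
  · have h := (hsew (t k) (r k) (t (k + 1)) (htr k hk).1 (htr k hk).2 (Z k)).1
    rw [← hhat k] at h
    have h := ENNReal.toReal_mono
      (ENNReal.mul_ne_top (by finiteness) (herr k hk).1) h
    rw [ENNReal.toReal_mul, ENNReal.toReal_mul] at h
    refine h.trans ?_
    simp only [ENNReal.coe_toReal]
    rw [hts k hk]
    refine mul_le_mul_of_nonneg_left (herr k hk).2 (mul_nonneg C.coe_nonneg ?_)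
    rw [← hts k hk]; positivity
  · have h := (hsew (t k) (r k) (t (k + 1)) (htr k hk).1 (htr k hk).2 (Z k)).2
    rw [← htilde k] at h
    have h := ENNReal.toReal_mono
      (ENNReal.mul_ne_top (by finiteness) (herr k hk).1) h
    rw [ENNReal.toReal_mul, ENNReal.toReal_mul, ← ENNReal.toReal_rpow, ← Real.sqrt_eq_rpow] at h
    refine h.trans ?_
    simp only [ENNReal.coe_toReal]
    rw [hts k hk]
    exact mul_le_mul_of_nonneg_left (herr k hk).2 (mul_nonneg C.coe_nonneg (Real.sqrt_nonneg _))

end Increments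

/-! ### Partitions and schemes as sequences. -/

namespace Partition

/-- The points of a partition as a sequence, constant from `t_N` on. -/
def times (π : Partition) (k : ℕ) : ℝ≥0 := π.t ⟨min k π.N, by omega⟩

lemma times_of_le (π : Partition) {k : ℕ} (hk : k ≤ π.N) : π.times k = π.t ⟨k, by omega⟩ := by
  simp [times, hk]

lemma times_zero (π : Partition) : π.times 0 = π.left := π.times_of_le (Nat.zero_le _)

lemma times_N (π : Partition) : π.times π.N = π.right := π.times_of_le le_rfl

lemma times_mono (π : Partition) : Monotone π.times := fun k l hkl =>
  π.strictMono.monotone (by simp only [Fin.mk_le_mk]; omega)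

lemma times_le_right (π : Partition) (k : ℕ) : π.times k ≤ π.right :=
  π.strictMono.monotone (Fin.le_last _)

lemma times_sub_le_mesh (π : Partition) {k : ℕ} (hk : k < π.N) :
    π.times (k + 1) - π.times k ≤ π.mesh := by
  rw [π.times_of_le hk, π.times_of_le hk.le]
  exact Finset.le_sup (f := fun i : Fin π.N => π.t i.succ - π.t i.castSucc)
    (Finset.mem_univ (⟨k, hk⟩ : Fin π.N))

lemma IsSimpleSubpartition.refl (π : Partition) : π.IsSimpleSubpartition π :=
  ⟨id, strictMono_id, rfl, rfl, fun _ => rfl, fun _ => by simp⟩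

/-- Strict monotonicity and the gap bound leave only jumps of 1 (no extra point) or 2 (one extra
point). -/
lemma IsSimpleSubpartition.exists_index {π' π : Partition} (h : π'.IsSimpleSubpartition π) :
    ∃ s : ℕ → ℕ, s 0 = 0 ∧ s π.N = π'.N ∧ (∀ k ≤ π.N, π'.times (s k) = π.times k) ∧
      ∀ k < π.N, s (k + 1) = s k + 1 ∨ s (k + 1) = s k + 2 := by
  obtain ⟨σ, hσ, h0, hN, ht, h2⟩ := h
  refine ⟨fun k => σ ⟨min k π.N, by omega⟩, ?_, ?_, fun k hk => ?_, fun k hk => ?_⟩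
  · have : (⟨min 0 π.N, by omega⟩ : Fin (π.N + 1)) = 0 := by ext; simp
    simp [h0]
  · have : (⟨min π.N π.N, by omega⟩ : Fin (π.N + 1)) = Fin.last _ := by ext; simp
    simp only [this, hN, Fin.val_last]
  · rw [π'.times_of_le (Fin.is_le _), times, ← ht]
  · have e1 : (⟨min k π.N, by omega⟩ : Fin (π.N + 1)) = (⟨k, hk⟩ : Fin π.N).castSucc := by
      ext; simp; omega
    have e2 : (⟨min (k + 1) π.N, by omega⟩ : Fin (π.N + 1)) = (⟨k, hk⟩ : Fin π.N).succ := by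
      ext; simp; omega
    have h3 := h2 ⟨k, hk⟩
    have h4 : (σ (⟨k, hk⟩ : Fin π.N).castSucc : ℕ) < σ (⟨k, hk⟩ : Fin π.N).succ :=
      hσ Fin.castSucc_lt_succ
    simp only [e1, e2]
    omega

end Partition

section Scheme

variable {S : Type*}

/-- The iterates of the scheme along a sequence of times. -/
def schemeSeq (Θ : ℝ≥0 → ℝ≥0 → S → S) (t : ℕ → ℝ≥0) (μ : S) : ℕ → S
  | 0 => μ
  | k + 1 => Θ (t k) (t (k + 1)) (schemeSeq Θ t μ k)

lemma foldl_eq_schemeSeq (Θ : ℝ≥0 → ℝ≥0 → S → S) (t : ℕ → ℝ≥0) (μ : S) (n : ℕ) :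
    Fin.foldl n (fun ν i => Θ (t i) (t (i + 1)) ν) μ = schemeSeq Θ t μ n := by
  induction n with
  | zero => simp [schemeSeq]
  | succ n ih => rw [Fin.foldl_succ_last]; simp [schemeSeq, ← ih]

lemma scheme_eq_schemeSeq (Θ : ℝ≥0 → ℝ≥0 → S → S) (π : Partition) (μ : S) :
    scheme Θ π μ = schemeSeq Θ π.times μ π.N := by
  rw [← foldl_eq_schemeSeq, scheme]
  congr 1
  ext ν i
  rw [π.times_of_le i.2.le, π.times_of_le i.2]
  rfl

end Scheme

/-! ### Realising couplings by random variables. -/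

section Coupling

/-- On an atomless space, every law on a standard Borel space is the law of an `ℱ 0`-measurable
random variable. -/
lemma Atomless.exists_map_eq {Ω : Type*} [mΩ : MeasurableSpace Ω] {P : Measure Ω}
    {ℱ : Filtration ℝ≥0 mΩ} (h : Atomless P ℱ) {Y : Type*} [MeasurableSpace Y]
    [StandardBorelSpace Y] (Γ : Measure Y) [IsProbabilityMeasure Γ] :
    ∃ Z : Ω → Y, Measurable[ℱ 0] Z ∧ P.map Z = Γ := by
  obtain ⟨U, hU, hUmap⟩ := h
  have : Nonempty Y := Γ.nonempty_of_neZero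
  obtain ⟨f, hf, hfmap⟩ := Γ.exists_measurable_map_eq
  -- `U` is uniform on `[0, 1]` only in law, so it is projected to take values there everywhere.
  let pr : ℝ → unitInterval := Set.projIcc 0 1 zero_le_one
  have hpr : Measurable pr := continuous_projIcc.measurable
  refine ⟨f ∘ pr ∘ U, hf.comp (hpr.comp hU), ?_⟩
  have hU' : Measurable U := hU.mono (ℱ.le 0) le_rfl
  rw [← Measure.map_map hf (hpr.comp hU'), ← Measure.map_map hpr hU', hUmap,
    ← unitInterval.measurePreserving_coe.map_eq, Measure.map_map hpr measurable_subtype_coe]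
  have : pr ∘ ((↑) : unitInterval → ℝ) = id := by
    ext x; simp [pr]
  rw [this, Measure.map_id, hfmap]

variable {H : Type*} [NormedAddCommGroup H] [MeasurableSpace H] {p : ℝ≥0}

instance (μ : Pp H p) : IsProbabilityMeasure μ.toMeasure :=
  inferInstanceAs (IsProbabilityMeasure (μ.1 : Measure H))

lemma Pp.norm_ne_top (μ : Pp H p) : μ.norm ≠ ∞ :=
  ENNReal.rpow_ne_top_of_nonneg (by positivity) μ.2.ne

lemma IsCoupling.isProbabilityMeasure {Γ : Measure (H × H)} {μ ν : Pp H p}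
    (h : IsCoupling Γ μ.toMeasure ν.toMeasure) : IsProbabilityMeasure Γ := by
  have : IsProbabilityMeasure (Γ.map Prod.fst) := by rw [h.1]; infer_instance
  exact Measure.isProbabilityMeasure_of_map Prod.fst

variable [BorelSpace H] [SecondCountableTopology H]

lemma Wp_le_rvNorm_sub {Ω : Type*} [MeasurableSpace Ω] {P : Measure Ω} {X Y : Ω → H}
    (hX : Measurable X) (hY : Measurable Y) {μ ν : Pp H p}
    (hμ : P.map X = μ.toMeasure) (hν : P.map Y = ν.toMeasure) :
    Wp μ ν ≤ rvNorm P p (fun ω => X ω - Y ω) := by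
  have hc : IsCoupling (P.map fun ω => (X ω, Y ω)) μ.toMeasure ν.toMeasure := by
    constructor
    · rw [Measure.map_map measurable_fst (hX.prodMk hY), ← hμ]; rfl
    · rw [Measure.map_map measurable_snd (hX.prodMk hY), ← hν]; rfl
  refine (iInf₂_le (f := fun (Γ : Measure (H × H)) (_ : IsCoupling Γ μ.toMeasure ν.toMeasure) =>
    (∫⁻ z, ‖z.1 - z.2‖ₑ ^ (p : ℝ) ∂Γ) ^ (1 / (p : ℝ))) _ hc).trans (le_of_eq ?_)
  rw [lintegral_map (by fun_prop) (hX.prodMk hY), rvNorm]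

/-- Every coupling of two laws is realised by `ℱ t`-measurable random variables. -/
lemma Atomless.exists_coupling_eq [CompleteSpace H] {Ω : Type*} [mΩ : MeasurableSpace Ω]
    {P : Measure Ω} {ℱ : Filtration ℝ≥0 mΩ} (h : Atomless P ℱ) (t : ℝ≥0) {μ ν : Pp H p}
    {Γ : Measure (H × H)} (hΓ : IsCoupling Γ μ.toMeasure ν.toMeasure) :
    ∃ X : Lpt H P ℱ p t × Lpt H P ℱ p t, P.map X.1.1 = μ.toMeasure ∧
      P.map X.2.1 = ν.toMeasure ∧
      rvNorm P p (fun ω => X.1.1 ω - X.2.1 ω) =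
        (∫⁻ z, ‖z.1 - z.2‖ₑ ^ (p : ℝ) ∂Γ) ^ (1 / (p : ℝ)) := by
  have := hΓ.isProbabilityMeasure
  obtain ⟨Z, hZ, hmap⟩ := h.exists_map_eq Γ
  have hZt : Measurable[ℱ t] Z := hZ.mono (ℱ.mono (zero_le : 0 ≤ t)) le_rfl
  have hZ' : Measurable Z := hZ.mono (ℱ.le 0) le_rfl
  have h1 : P.map (fun ω => (Z ω).1) = μ.toMeasure := by
    rw [← hΓ.1, ← hmap, Measure.map_map measurable_fst hZ']; rfl
  have h2 : P.map (fun ω => (Z ω).2) = ν.toMeasure := by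
    rw [← hΓ.2, ← hmap, Measure.map_map measurable_snd hZ']; rfl
  refine ⟨(⟨fun ω => (Z ω).1, measurable_fst.comp hZt, ?_⟩,
    ⟨fun ω => (Z ω).2, measurable_snd.comp hZt, ?_⟩), h1, h2, ?_⟩
  · rw [rvNorm_eq_norm_of_map_eq hZ'.fst h1]; exact μ.norm_ne_top.lt_top
  · rw [rvNorm_eq_norm_of_map_eq hZ'.snd h2]; exact ν.norm_ne_top.lt_top
  · rw [rvNorm, ← hmap, lintegral_map (by fun_prop) hZ']

end Coupling

/-! ### Estimates for the schemes. -/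

section Schemes

variable {p : ℝ≥0}

/-- Being a bound on laws, this is available for either scheme regardless of which component of a
chain carries it. It comes from an auxiliary chain, started from the diagonal coupling with middle
times `r = t`, whose first component has the law of the scheme. -/
lemma exists_schemeSeq_norm_bound (hp : 2 ≤ p) (T L : ℝ≥0) :
    ∃ B : ℝ, 0 ≤ B ∧ ∀ (H : Type*) [NormedAddCommGroup H] [InnerProductSpace ℝ H]
      [CompleteSpace H] [SecondCountableTopology H] [MeasurableSpace H] [BorelSpace H]
      (Ω : Type*) [mΩ : MeasurableSpace Ω] (P : Measure Ω)
      [IsProbabilityMeasure P] (ℱ : Filtration ℝ≥0 mΩ) (Θ : ℝ≥0 → ℝ≥0 → Pp H p → Pp H p)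
      (𝒳 : CouplingOperator H P ℱ p), Atomless P ℱ → (∀ t μ, Θ t t μ = μ) →
      Representation Θ 𝒳 → Growth 𝒳 L → ∀ (t : ℕ → ℝ≥0) (μ : Pp H p) (n : ℕ),
      Monotone t → (∀ k, t k ≤ T) → (schemeSeq Θ t μ n).norm.toReal ≤ B * (1 + μ.norm.toReal) := by
  obtain ⟨B, hB, hbound⟩ := exists_chain_growth_bound hp T L
  refine ⟨B, hB, ?_⟩
  intro H _ _ _ _ _ _ Ω mΩ P _ ℱ Θ 𝒳 hA hΘ hrep hgrowth t μ n ht htT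
  have hΓ : IsCoupling (μ.toMeasure.map fun x => (x, x)) μ.toMeasure μ.toMeasure := by
    constructor
    · rw [Measure.map_map measurable_fst (by fun_prop)]
      exact Measure.map_id
    · rw [Measure.map_map measurable_snd (by fun_prop)]
      exact Measure.map_id
  obtain ⟨X, hX1, hX2, -⟩ := hA.exists_coupling_eq (t 0) hΓ
  have htr : ∀ k < n, t k ≤ t k ∧ t k ≤ t (k + 1) := fun k _ => ⟨le_rfl, ht k.le_succ⟩
  have hlaw := (map_chain_eq hrep (X := X) (μ := schemeSeq Θ t μ) (ν := schemeSeq Θ t μ) htr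
    (fun _ _ => rfl) (fun k _ => by rw [hΘ]; rfl) ⟨hX1, hX2⟩).1
  have h := hbound H Ω P ℱ 𝒳 hgrowth t t X n htT htr
  rwa [rvNorm_eq_norm_of_map_eq (Lpt.measurable _) hlaw,
    rvNorm_eq_norm_of_map_eq (Lpt.measurable _) hX1] at h

lemma exists_Wp_scheme_le (hp : 2 ≤ p) (T L C : ℝ≥0) :
    ∃ A : ℝ≥0, ∀ (H : Type*) [NormedAddCommGroup H] [InnerProductSpace ℝ H]
      [CompleteSpace H] [SecondCountableTopology H] [MeasurableSpace H] [BorelSpace H]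
      (Ω : Type*) [mΩ : MeasurableSpace Ω] (P : Measure Ω) [IsProbabilityMeasure P]
      (ℱ : Filtration ℝ≥0 mΩ), Atomless P ℱ → ∀ (Θ : ℝ≥0 → ℝ≥0 → Pp H p → Pp H p),
      (∀ t μ, Θ t t μ = μ) → ∀ β : ℝ, 0 < β → SewingProperty P ℱ Θ β L C →
      ∀ π : Partition, π.right ≤ T → ∀ μ ν : Pp H p,
      ∀ π' : Partition, π'.IsSimpleSubpartition π →
        Wp (scheme Θ π μ) (scheme Θ π' ν) ≤
          A * Wp μ ν +
            A * (1 + μ.norm + ν.norm) * ((π.right - π.left : ℝ≥0) : ℝ≥0∞) ^ (1 / 2 : ℝ) *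
              (π.mesh : ℝ≥0∞) ^ β := by
  obtain ⟨B, hB, hbound⟩ := exists_schemeSeq_norm_bound hp T L
  obtain ⟨G, hG, hdiff⟩ := exists_chain_difference_bound hp T C
  -- The factor `1 + 2 * B` absorbs the a priori bounds on both components. Adding 1 makes the
  -- constant nonzero, so that it commutes with the infimum in `Wp` and sends the value `∞` at
  -- non-couplings to `∞`.
  refine ⟨(G * (1 + 2 * B)).toNNReal + 1, ?_⟩
  intro H _ _ _ _ _ _ Ω mΩ P _ ℱ hA Θ hΘ β hβ ⟨𝒳, hrep, hgrowth, hsew⟩ π hπ μ ν π' hπ'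
  have hp0 : p ≠ 0 := by rintro rfl; norm_num at hp
  set A := (G * (1 + 2 * B)).toNNReal + 1 with hAdef
  have hAG : G * (1 + 2 * B) ≤ A := by
    rw [hAdef, NNReal.coe_add, Real.coe_toNNReal _ (by positivity)]; simp
  have hAG' : G ≤ A := (le_mul_of_one_le_right hG (by linarith)).trans hAG
  obtain ⟨s, hs0, hsN, hst, hs⟩ := hπ'.exists_index
  have hright : π'.right = π.right := by
    rw [← π.times_N, ← π'.times_N, ← hsN, hst _ le_rfl]
  set t := π.times with ht
  -- couple the initial laws
  conv_rhs => rw [Wp]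
  rw [ENNReal.mul_iInf_of_ne (by positivity) ENNReal.coe_ne_top, ENNReal.iInf_add]
  refine le_iInf fun Γ => ?_
  rcases Classical.em (IsCoupling Γ μ.toMeasure ν.toMeasure) with hΓ | hΓ
  swap
  · rw [iInf_neg hΓ, ENNReal.mul_top (by positivity), top_add]; exact le_top
  rw [iInf_pos hΓ]
  obtain ⟨X, hX1, hX2, hXΓ⟩ := hA.exists_coupling_eq (t 0) hΓ
  rw [← hXΓ]
  -- The next point of `π'` after `t k`: the extra point if there is one, otherwise `t (k + 1)`.
  set r : ℕ → ℝ≥0 := fun k => π'.times (s k + 1) with hr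
  have htr : ∀ k < π.N, t k ≤ r k ∧ r k ≤ t (k + 1) := by
    intro k hk
    rw [← hst k hk.le, ← hst (k + 1) hk]
    exact ⟨π'.times_mono (by omega), π'.times_mono (by have := hs k hk; omega)⟩
  set m : ℕ → Pp H p := schemeSeq Θ t μ with hm
  set q : ℕ → Pp H p := fun k => schemeSeq Θ π'.times ν (s k) with hq
  have hqstep : ∀ k < π.N, q (k + 1) = Θ (r k) (t (k + 1)) (Θ (t k) (r k) (q k)) := by
    intro k hk
    rw [← hst k hk.le, ← hst (k + 1) hk]
    rcases hs k hk with h | h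
    -- Without an extra point the second map is `Θ (t (k + 1)) (t (k + 1))`, the identity.
    · simp only [hq, hr, h, hΘ]; rfl
    · simp only [hq, hr, h]; rfl
  have hlaw (k) (hk : k ≤ π.N) := map_chain_eq hrep (X := X) (μ := m) (ν := q) (n := k)
    (fun j hj => htr j (by omega)) (fun _ _ => rfl) (fun j hj => hqstep j (by omega))
    ⟨hX1, by simpa [hq, hs0, schemeSeq] using hX2⟩
  set a := μ.norm.toReal with ha
  set b := ν.norm.toReal with hb
  have ha0 : 0 ≤ a := ENNReal.toReal_nonneg
  have hb0 : 0 ≤ b := ENNReal.toReal_nonneg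
  -- The second component has the law of the scheme along `π'` at index `s k`, so its norm is
  -- bounded without any growth assumption on `𝒳²`.
  have hnorm : ∀ k < π.N, (rvNorm P p (chain 𝒳 t r X k).1.1).toReal +
      (rvNorm P p (chain 𝒳 t r X k).2.1).toReal ≤ B * (1 + a) + B * (1 + b) := by
    intro k hk
    rw [rvNorm_eq_norm_of_map_eq (Lpt.measurable _) (hlaw k hk.le).1,
      rvNorm_eq_norm_of_map_eq (Lpt.measurable _) (hlaw k hk.le).2]
    exact add_le_add
      (hbound H Ω P ℱ Θ 𝒳 hA hΘ hrep hgrowth t μ k π.times_mono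
        fun k => (π.times_le_right k).trans hπ)
      (hbound H Ω P ℱ Θ 𝒳 hA hΘ hrep hgrowth π'.times ν (s k) π'.times_mono
        fun k => (π'.times_le_right k).trans (hright.trans_le hπ))
  have key := hdiff H Ω P ℱ 𝒳 β hβ hsew t r X π.N (B * (1 + a) + B * (1 + b)) π.mesh
    (fun k => (π.times_le_right k).trans hπ) htr (by positivity) hnorm
    (fun k hk => π.times_sub_le_mesh hk)
  have hW : Wp (scheme Θ π μ) (scheme Θ π' ν) ≤
      rvNorm P p (fun ω => (chain 𝒳 t r X π.N).1.1 ω - (chain 𝒳 t r X π.N).2.1 ω) := by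
    refine Wp_le_rvNorm_sub (Lpt.measurable _) (Lpt.measurable _) ?_ ?_
    · rw [(hlaw π.N le_rfl).1, scheme_eq_schemeSeq]
    · rw [(hlaw π.N le_rfl).2, scheme_eq_schemeSeq, hq, ← hsN]
  refine hW.trans ?_
  have hfin {u : ℝ≥0} (Z : Lpt H P ℱ p u × Lpt H P ℱ p u) :
      rvNorm P p (fun ω => Z.1.1 ω - Z.2.1 ω) ≠ ∞ := by
    rw [rvNorm_eq_eLpNorm hp0]; exact ((Z.1.memLp hp0).sub (Z.2.memLp hp0)).2.ne
  have f1 := hfin X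
  have f2 := μ.norm_ne_top
  have f3 := ν.norm_ne_top
  have f4 : ((π.right - π.left : ℝ≥0) : ℝ≥0∞) ^ (1 / 2 : ℝ) ≠ ∞ :=
    ENNReal.rpow_ne_top_of_nonneg (by norm_num) ENNReal.coe_ne_top
  have f5 : (π.mesh : ℝ≥0∞) ^ β ≠ ∞ := ENNReal.rpow_ne_top_of_nonneg hβ.le ENNReal.coe_ne_top
  rw [← ENNReal.toReal_le_toReal (hfin _) (by finiteness), ENNReal.toReal_add (by finiteness)
    (by finiteness), ENNReal.toReal_mul, ENNReal.toReal_mul, ENNReal.toReal_mul,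
    ENNReal.toReal_mul, ENNReal.toReal_add (by finiteness) f3, ENNReal.toReal_add (by simp) f2,
    ← ENNReal.toReal_rpow, ← ENNReal.toReal_rpow, ← Real.sqrt_eq_rpow]
  simp only [ENNReal.coe_toReal, ENNReal.toReal_one]
  have hτ : ((π.right - π.left : ℝ≥0) : ℝ) = t π.N - t 0 := by
    rw [ht, π.times_N, π.times_zero, NNReal.coe_sub]
    rw [← π.times_zero]; exact π.times_le_right 0
  rw [hτ, ← ha, ← hb]
  refine key.trans ?_
  have g1 : 1 + (B * (1 + a) + B * (1 + b)) ≤ (1 + 2 * B) * (1 + a + b) := by nlinarith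
  have hδ : 0 ≤ (rvNorm P p fun ω => X.1.1 ω - X.2.1 ω).toReal := ENNReal.toReal_nonneg
  clear_value a b A
  generalize (rvNorm P p fun ω => X.1.1 ω - X.2.1 ω).toReal = δ at hδ ⊢
  have hM : 0 ≤ (π.mesh : ℝ) ^ β := by positivity
  generalize (π.mesh : ℝ) ^ β = M at hM ⊢
  have hθ : 0 ≤ √((t π.N : ℝ) - t 0) := Real.sqrt_nonneg _
  generalize √((t π.N : ℝ) - t 0) = θ at hθ ⊢
  calc G * (δ + θ * ((1 + (B * (1 + a) + B * (1 + b))) * M))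
      ≤ G * (δ + θ * (((1 + 2 * B) * (1 + a + b)) * M)) := by gcongr
    _ = G * δ + (G * (1 + 2 * B)) * (1 + a + b) * θ * M := by ring
    _ ≤ A * δ + A * (1 + a + b) * θ * M := by gcongr

end Schemes

end WassersteinSewing

theorem lemma2p4 (p : ℝ≥0) (hp : 2 ≤ p) (T : ℝ≥0) (hT : 0 < T)
    (Lsew Csew : ℝ≥0) (hL : 0 < Lsew) (hC : 0 < Csew) :
    -- `CT` depends on `p`, `T`, `Lsew`, `Csew` only
    ∃ CT : ℝ≥0,
      ∀ (H : Type*) [NormedAddCommGroup H] [InnerProductSpace ℝ H] [CompleteSpace H]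
        [SecondCountableTopology H] [MeasurableSpace H] [BorelSpace H]
        (Ω : Type*) [mΩ : MeasurableSpace Ω] (P : Measure Ω) [IsProbabilityMeasure P]
        (ℱ : Filtration ℝ≥0 mΩ) (_hA : Atomless P ℱ)
        (Θ : ℝ≥0 → ℝ≥0 → Pp H p → Pp H p) (_hΘ : ∀ t μ, Θ t t μ = μ)
        (β : ℝ) (_hβ : 0 < β) (_hS : SewingProperty P ℱ Θ β Lsew Csew)
        (π : Partition) (_hπ : π.right ≤ T) (μ ν : Pp H p),
        (∀ π' : Partition, π'.IsSimpleSubpartition π →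
          Wp (scheme Θ π μ) (scheme Θ π' ν) ≤
            CT * Wp μ ν +
              CT * (1 + μ.norm + ν.norm) * ((π.right - π.left : ℝ≥0) : ℝ≥0∞) ^ (1 / 2 : ℝ) *
                (π.mesh : ℝ≥0∞) ^ β) ∧
        Wp (scheme Θ π μ) (scheme Θ π ν) ≤
          CT * Wp μ ν +
            CT * (1 + μ.norm + ν.norm) * ((π.right - π.left : ℝ≥0) : ℝ≥0∞) ^ (1 / 2 : ℝ) *
              (π.mesh : ℝ≥0∞) ^ β := by
  obtain ⟨A, hA⟩ := exists_Wp_scheme_le hp T Lsew Csew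
  refine ⟨A, ?_⟩
  intro H _ _ _ _ _ _ Ω mΩ P _ ℱ hU Θ hΘ β hβ hS π hπ μ ν
  have h := hA H Ω P ℱ hU Θ hΘ β hβ hS π hπ μ ν
  exact ⟨h, h π (.refl π)⟩
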